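/- **Meta log-Sobolev inequality.** Let $H$ be the Hilbert space of a single bosonic mode, with orthonormal basis of Fock states $|0\rangle,|1\rangle,|2\rangle,\dots$, annihilation operator $\mathbf a|n\rangle=\sqrt n\,|n-1\rangle$ and creation operator $\mathbf a^\dagger|n\rangle=\sqrt{n+1}\,|n+1\rangle$. Let $\nu_0,\nu_1,\omega\ge 0$ and $p\ge 1$, let $\hat p$ be given by $\frac1p+\frac1{\hat p}=1$, and let $\mathcal L=\nu_0\mathcal L_0+\nu_1\mathcal L_1$ with $$\mathcal L_0(X)=\tfrac12\{\mathbf a\mathbf a^\dagger,X\}-\mathbf a^\dagger X\mathbf a,\qquad \mathcal L_1(X)=\tfrac12\{\mathbf a^\dagger\mathbf a,X\}-\mathbf a X\mathbf a^\dagger ,$$ understood in the sense of quadratic forms. For a state $\rho$ ($\rho\ge 0$, $\mathrm{tr}\,\rho=1$) with finite mean photon number, $\mathrm{tr}(\rho\,\mathbf a^\dagger\mathbf a)<\infty$, set $$\Upsilon(\rho)=\hat p\,\big\langle\mathcal L(\rho^{1/p}),\rho^{1/\hat p}\big\rangle+\omega\,\mathrm{tr}(\rho\,\mathbf a^\dagger\mathbf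 a)+S(\rho),$$ where $\langle X,Y\rangle=\mathrm{tr}(X^\dagger Y)$, with the trace evaluated in an orthonormal basis of eigenvectors of $\rho$, and $S(\rho)=-\mathrm{tr}(\rho\log\rho)$. For $p=1$ the first term is $\langle\mathcal L(\rho),\log\rho\rangle$, understood as $$\sum_{k,l}\lambda_k(\log\lambda_k-\log\lambda_l)\Big(\nu_0\,|\langle\psi_l|\mathbf a^\dagger|\psi_k\rangle|^2+\nu_1\,|\langle\psi_l|\mathbf a|\psi_k\rangle|^2\Big)\in(-\infty,+\infty]$$ for an orthonormal eigenbasis $\rho\psi_k=\lambda_k\psi_k$, with $\log 0=-\infty$ and $0\cdot\infty=0$ (terms with $\lambda_k=0$ vanish). For $0<x<1$ let $\tau_x=(1-x)\sum_{n\ge 0}x^n|n\rangle\langle n|$ be the thermal states, and let $$\eta_{\mathrm{th}}=\inf_{0<x<1}\Upsilon(\tau_x).$$ Then every single-mode state $\rho$ with $\mathrm{tr}(\rho\,\mathbf a^\dagger\mathbf a)<\infty$ satisfies $\Upsilon(\rho)\ge\eta_{\mathrm{th}}$. -/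

import Mathlib

open scoped ENNReal InnerProductSpace

section SingleMode

variable {H : Type*} [NormedAddCommGroup H] [InnerProductSpace ℂ H] [CompleteSpace H]

/- A single bosonic mode is a complex Hilbert space `H` together with an orthonormal (Hilbert) basis
`e 0, e 1, e 2, …` of `H`, the Fock states. -/

/-- The annihilation operator, `a e_n = √n e_{n-1}`. It is unbounded, with natural domain
`{ψ | ∑ n |⟨e_n, ψ⟩|² < ∞}`: this is exactly where the series below converges. Outside of its domain
the value is `0` and carries no meaning. -/
noncomputable def annihilation (e : HilbertBasis ℕ ℂ H) (ψ : H) : H :=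
  ∑' n : ℕ, ((Real.sqrt (n + 1) : ℂ) * ⟪e (n + 1), ψ⟫_ℂ) • e n

/-- The creation operator, `a† e_n = √(n+1) e_{n+1}`, the adjoint of `annihilation e`, with the same
natural domain and the same convention outside of it. -/
noncomputable def creation (e : HilbertBasis ℕ ℂ H) (ψ : H) : H :=
  ∑' n : ℕ, ((Real.sqrt (n + 1) : ℂ) * ⟪e n, ψ⟫_ℂ) • e (n + 1)

/-- Single-mode quantum states (density operators): positive operators of trace one. -/
structure IsState (e : HilbertBasis ℕ ℂ H) (ρ : H →L[ℂ] H) : Prop where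
  isPositive : ρ.IsPositive
  trace_eq_one : HasSum (fun n => ⟪e n, ρ (e n)⟫_ℂ) 1

/-- The mean photon number `tr (ρ a†a) = ∑ n ⟨e_n, ρ e_n⟩` of a positive operator, possibly `∞`. -/
noncomputable def meanPhotonNumber (e : HilbertBasis ℕ ℂ H) (ρ : H →L[ℂ] H) : ℝ≥0∞ :=
  ∑' n : ℕ, ENNReal.ofReal (n * (⟪e n, ρ (e n)⟫_ℂ).re)

/-- The von Neumann entropy `S(ρ) = tr (-ρ log ρ)` of a state. The operator `-ρ log ρ` is given by
the continuous functional calculus for `t ↦ - t log t` (with value `0` at `t = 0`) and is positive,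
because the spectrum of a state is contained in `[0, 1]`. -/
noncomputable def entropy (e : HilbertBasis ℕ ℂ H) (ρ : H →L[ℂ] H) : ℝ≥0∞ :=
  ∑' n : ℕ, ENNReal.ofReal (⟪e n, cfc Real.negMulLog ρ (e n)⟫_ℂ).re

/-- The thermal state `τ_x = (1 - x) ∑ xⁿ |e_n⟩⟨e_n|`, for `x = e^{-β}` in `(0, 1)`
(a norm convergent series). -/
noncomputable def thermalState (e : HilbertBasis ℕ ℂ H) (x : ℝ) : H →L[ℂ] H :=
  ∑' n : ℕ, (((1 - x) * x ^ n : ℝ) : ℂ) • InnerProductSpace.rankOne ℂ (e n) (e n)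

/-- For an operator `K` with adjoint `K'`, the matrix element `⟨φ, 𝓛_K(X) ψ⟩` of
`𝓛_K(X) = (K†K X + X K†K) / 2 - K X K†`, in the sense of quadratic forms. -/
noncomputable def jumpForm (K K' : H → H) (X : H →L[ℂ] H) (φ ψ : H) : ℂ :=
  (1 / 2 : ℂ) * (⟪K φ, K (X ψ)⟫_ℂ + ⟪K (X.adjoint φ), K ψ⟫_ℂ) - ⟪K' φ, X (K' ψ)⟫_ℂ

/-- The matrix element `⟨φ, 𝓛(X) ψ⟩` of the phase-covariant Gaussian Lindbladian
`𝓛 = ν₀ 𝓛₀ + ν₁ 𝓛₁`, with `𝓛₀(X) = {a a†, X} / 2 - a† X a` and `𝓛₁(X) = {a† a, X} / 2 - a X a†`. -/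
noncomputable def lindbladForm (e : HilbertBasis ℕ ℂ H) (ν₀ ν₁ : ℝ) (X : H →L[ℂ] H) (φ ψ : H) : ℂ :=
  ν₀ * jumpForm (creation e) (annihilation e) X φ ψ
    + ν₁ * jumpForm (annihilation e) (creation e) X φ ψ

/-- `ψ` is an orthonormal basis of eigenvectors of `ρ`. -/
def IsEigenbasis (ρ : H →L[ℂ] H) (ψ : HilbertBasis ℕ ℂ H) : Prop :=
  ∀ k, ∃ c : ℂ, ρ (ψ k) = c • ψ k

/-- Parseval's identity. -/
theorem hasSum_sq_norm_inner {E : Type*} [NormedAddCommGroup E] [InnerProductSpace ℂ E]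
    (e : HilbertBasis ℕ ℂ E) (x : E) :
    HasSum (fun n => ‖⟪e n, x⟫_ℂ‖ ^ 2) (‖x‖ ^ 2) := by
  have h := (e.hasSum_inner_mul_inner x x).mapL Complex.reCLM
  convert h using 1
  · funext n
    rw [← inner_conj_symm x (e n), ← Complex.normSq_eq_conj_mul_self]
    rw [Complex.normSq_eq_norm_sq, Complex.reCLM_apply, Complex.ofReal_re]
  · simpa using (inner_self_eq_norm_sq (𝕜 := ℂ) x).symm

/-- States are compact operators. -/
theorem IsState.isCompactOperator {e : HilbertBasis ℕ ℂ H} {ρ : H →L[ℂ] H} (h : IsState e ρ) :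
    IsCompactOperator ρ := by
  have hpos : 0 ≤ ρ := (ContinuousLinearMap.nonneg_iff_isPositive ρ).2 h.isPositive
  have hsq : Summable fun n => ‖ρ (e n)‖ ^ 2 := by
    have hre := (h.trace_eq_one.mapL Complex.reCLM).summable
    obtain ⟨S, hS, hSρ⟩ : ∃ S : H →L[ℂ] H, S.IsSymmetric ∧ S * S = ρ :=
      ⟨CFC.sqrt ρ, ((ContinuousLinearMap.nonneg_iff_isPositive _).1 (CFC.sqrt_nonneg ρ)).isSymmetric,
        CFC.sqrt_mul_sqrt_self ρ hpos⟩
    refine Summable.of_nonneg_of_le (fun n => by positivity) (fun n => ?_) (hre.mul_left (‖S‖ ^ 2))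
    have h1 : (⟪e n, ρ (e n)⟫_ℂ).re = ‖S (e n)‖ ^ 2 := by
      rw [← hSρ]
      have := hS (e n) (S (e n))
      simp only [ContinuousLinearMap.coe_coe] at this
      change (⟪e n, S (S (e n))⟫_ℂ).re = _
      rw [← this]
      exact inner_self_eq_norm_sq (𝕜 := ℂ) _
    have h2 : ‖ρ (e n)‖ ≤ ‖S‖ * ‖S (e n)‖ := by
      rw [← hSρ]; exact S.le_opNorm _
    simp only [Complex.reCLM_apply, h1, ← mul_pow]
    gcongr
  let F : ℕ → H →L[ℂ] H := fun N =>
    ∑ n ∈ Finset.range N, InnerProductSpace.rankOne ℂ (e n) (ρ (e n))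
  have hF : ∀ N, IsCompactOperator (F N) := by
    intro N
    induction N with
    | zero => simpa [F] using (isCompactOperator_zero : IsCompactOperator (0 : H → H))
    | succ N ih =>
      have : F (N + 1) = F N + InnerProductSpace.rankOne ℂ (e N) (ρ (e N)) :=
        Finset.sum_range_succ _ _
      rw [this, FunLike.coe_add]
      refine ih.add ?_
      rw [InnerProductSpace.rankOne_def']
      have hc : IsCompactOperator (innerSL ℂ (ρ (e N))) :=
        isCompactOperator_of_locallyCompactSpace_dom _
      rw [ContinuousLinearMap.coe_comp]
      exact hc.clm_comp _
  refine isCompactOperator_of_tendsto (l := Filter.atTop) (F := F) ?_ (.of_forall hF)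
  rw [tendsto_iff_norm_sub_tendsto_zero]
  have htail := (tendsto_sum_nat_add fun n => ‖ρ (e n)‖ ^ 2).sqrt
  rw [Real.sqrt_zero] at htail
  refine squeeze_zero (fun _ => norm_nonneg _) (fun N => ?_) htail
  refine ContinuousLinearMap.opNorm_le_bound _ (Real.sqrt_nonneg _) fun ψ => ?_
  have hsN : Summable fun n => ‖ρ (e (n + N))‖ ^ 2 := (summable_nat_add_iff N).2 hsq
  have hcoef : ∀ m, ⟪e m, (F N - ρ) ψ⟫_ℂ = if m < N then 0 else - ⟪ρ (e m), ψ⟫_ℂ := by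
    intro m
    have hs : ⟪ρ (e m), ψ⟫_ℂ = ⟪e m, ρ ψ⟫_ℂ := h.isPositive.isSymmetric (e m) ψ
    have ho := orthonormal_iff_ite.1 e.orthonormal m
    simp only [F, sub_apply, sum_apply, inner_sub_right,
      InnerProductSpace.rankOne_apply, inner_sum, inner_smul_right, ho, ← hs]
    by_cases hm : m < N <;> simp [hm]
  have hp := hasSum_sq_norm_inner e ((F N - ρ) ψ)
  have hp' : ‖(F N - ρ) ψ‖ ^ 2 ≤ (∑' n, ‖ρ (e (n + N))‖ ^ 2) * ‖ψ‖ ^ 2 := by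
    rw [← hp.tsum_eq, ← hp.summable.sum_add_tsum_nat_add N, ← tsum_mul_right]
    rw [Finset.sum_eq_zero, zero_add]
    · refine Summable.tsum_le_tsum (fun n => ?_) ((summable_nat_add_iff N).2 hp.summable)
        (hsN.mul_right _)
      rw [hcoef, if_neg (by omega), norm_neg, ← mul_pow]
      gcongr
      exact norm_inner_le_norm _ _
    · intro n hn
      rw [hcoef, if_pos (Finset.mem_range.1 hn)]
      simp
  refine le_of_sq_le_sq ?_ (by positivity)
  rwa [mul_pow, Real.sq_sqrt (tsum_nonneg fun _ => by positivity)]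

/-- Spectral theorem: every state has an orthonormal basis of eigenvectors. -/
theorem IsState.exists_isEigenbasis {e : HilbertBasis ℕ ℂ H} {ρ : H →L[ℂ] H} (h : IsState e ρ) :
    ∃ ψ : HilbertBasis ℕ ℂ H, IsEigenbasis ρ ψ := by
  have hsymm := h.isPositive.isSymmetric
  have hbot := ContinuousLinearMap.orthogonalComplement_iSup_eigenspaces_eq_bot
    h.isCompactOperator hsymm
  have hfam := hsymm.orthogonalFamily_eigenspaces
  have hcl : ∀ μ : ℂ, IsClosed (Module.End.eigenspace (ρ : H →ₗ[ℂ] H) μ : Set H) := by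
    intro μ
    have : (Module.End.eigenspace (ρ : H →ₗ[ℂ] H) μ : Set H) = {x | ρ x = μ • x} := by
      ext x; simp
    rw [this]
    exact isClosed_eq ρ.continuous (continuous_const_smul μ)
  have : ∀ μ : ℂ, CompleteSpace (Module.End.eigenspace (ρ : H →ₗ[ℂ] H) μ) :=
    fun μ => (hcl μ).completeSpace_coe
  choose w b hb using fun μ : ℂ =>
    exists_hilbertBasis ℂ (Module.End.eigenspace (ρ : H →ₗ[ℂ] H) μ)
  let v : (Σ μ : ℂ, w μ) → H := fun a => (b a.1 a.2 : H)
  have hv : Orthonormal ℂ v := hfam.orthonormal_sigma_orthonormal fun μ => (b μ).orthonormal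
  have hvbot : (Submodule.span ℂ (Set.range v))ᗮ = ⊥ := by
    rw [eq_bot_iff, ← hbot]
    intro x hx
    rw [Submodule.mem_orthogonal'] at hx
    rw [← Submodule.iInf_orthogonal, Submodule.mem_iInf]
    intro μ
    rw [Submodule.mem_orthogonal']
    intro y hy
    have hz := (b μ).hasSum_repr ⟨y, hy⟩
    have hz' := (hz.mapL (Submodule.subtypeL _)).mapL (innerSL ℂ x)
    refine hz'.unique ?_
    convert hasSum_zero with i
    have : ⟪x, v ⟨μ, i⟩⟫_ℂ = 0 := hx _ (Submodule.subset_span ⟨_, rfl⟩)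
    simpa [inner_smul_right, v] using Or.inr this
  have hcount : Countable (Σ μ : ℂ, w μ) := by
    rw [← Set.countable_univ_iff]
    refine (Set.countable_iUnion fun n : ℕ =>
      (hv.inner_products_summable (e n)).countable_support).mono fun a _ => ?_
    by_contra hcon
    simp only [Set.mem_iUnion, Function.mem_support, not_exists, not_not] at hcon
    have hzero : ∀ n, ‖⟪e n, v a⟫_ℂ‖ ^ 2 = 0 := fun n => by rw [norm_inner_symm]; exact hcon n
    have h0 := (hasSum_sq_norm_inner e (v a)).unique (by simpa only [hzero] using hasSum_zero)
    rw [hv.1 a] at h0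
    norm_num at h0
  have hinf : Infinite (Σ μ : ℂ, w μ) := by
    by_contra hfin
    rw [not_infinite_iff_finite] at hfin
    have := Fintype.ofFinite (Σ μ : ℂ, w μ)
    have hfd : FiniteDimensional ℂ H :=
      ((HilbertBasis.mkOfOrthogonalEqBot hv hvbot).toOrthonormalBasis).toBasis.finiteDimensional_of_finite
    have := e.orthonormal.linearIndependent.finite
    exact not_finite ℕ
  obtain ⟨f⟩ := nonempty_equiv_of_countable (α := ℕ) (β := Σ μ : ℂ, w μ)
  refine ⟨HilbertBasis.mkOfOrthogonalEqBot (hv.comp f f.injective) ?_, fun k => ⟨(f k).1, ?_⟩⟩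
  · rwa [f.surjective.range_comp]
  · rw [HilbertBasis.coe_mkOfOrthogonalEqBot]
    exact Module.End.mem_eigenspace_iff.1 (b (f k).1 (f k).2).2

/-- An orthonormal basis of eigenvectors of `ρ`; every state has one. The quantities defined through
it below do not depend on the choice. -/
noncomputable def eigenbasis (e : HilbertBasis ℕ ℂ H) (ρ : H →L[ℂ] H) : HilbertBasis ℕ ℂ H :=
  open scoped Classical in if h : ∃ ψ : HilbertBasis ℕ ℂ H, IsEigenbasis ρ ψ then h.choose else e

/-- The eigenvalue `λ_k = ⟨ψ_k, ρ ψ_k⟩` of a state `ρ` for the vector `ψ_k` of its eigenbasis. -/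
noncomputable def eigenvalue (e : HilbertBasis ℕ ℂ H) (ρ : H →L[ℂ] H) (k : ℕ) : ℝ :=
  (⟪eigenbasis e ρ k, ρ (eigenbasis e ρ k)⟫_ℂ).re

/-- The (unordered) sum of a family of extended reals: the sum of the positive parts minus the sum
of the negative parts. -/
noncomputable def extSum {ι : Type*} (f : ι → EReal) : EReal :=
  ((∑' i, (f i).toENNReal : ℝ≥0∞) : EReal) - ((∑' i, (-f i).toENNReal : ℝ≥0∞) : EReal)

/-- The Hilbert-Schmidt pairing `⟨𝓛(ρ^{1/p}), ρ^{1/q}⟩ = tr (𝓛(ρ^{1/p})† ρ^{1/q})`, `1 < p`,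
`1/p + 1/q = 1`. The trace is computed in an eigenbasis `ψ` of `ρ`, that is, as
`∑ k, ⟨𝓛(ρ^{1/p}) ψ_k, ρ^{1/q} ψ_k⟩` (the terms are real). If `ρ` has finite mean photon number, then
`ρ^{1/q} ψ_k` and, if it is not zero, `ψ_k` are in the domain of `a` and `a†`. -/
noncomputable def powerPairing (e : HilbertBasis ℕ ℂ H) (ν₀ ν₁ p : ℝ) (ρ : H →L[ℂ] H) : EReal :=
  extSum fun k : ℕ =>
    ((lindbladForm e ν₀ ν₁ (ρ ^ (1 / p)) ((ρ ^ (1 / p.conjExponent)) (eigenbasis e ρ k))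
      (eigenbasis e ρ k)).re : EReal)

/-- The pairing `⟨𝓛_K(ρ), log ρ⟩`. Here `log ρ` is unbounded (with value `-∞` on the kernel of `ρ`),
so both terms of `tr (K†K ρ log ρ) - tr (K ρ K† log ρ)` are expanded in an eigenbasis `ψ` of `ρ` with
eigenvalues `λ` and summed together, which gives
`∑ k l, λ_k (log λ_k - log λ_l) |⟨ψ_l, K ψ_k⟩|²`. It is a sum in `(-∞, ∞]`, with `log 0 = -∞` and
`0 * ∞ = 0`, and it is the limit for `p → 1⁺` of `q ⟨𝓛_K(ρ^{1/p}), ρ^{1/q}⟩`. -/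
noncomputable def jumpLogPairing (e : HilbertBasis ℕ ℂ H) (K : H → H) (ρ : H →L[ℂ] H) : EReal :=
  extSum fun kl : ℕ × ℕ =>
    (eigenvalue e ρ kl.1 : EReal) *
      (ENNReal.log (ENNReal.ofReal (eigenvalue e ρ kl.1))
        - ENNReal.log (ENNReal.ofReal (eigenvalue e ρ kl.2))) *
      ((‖⟪eigenbasis e ρ kl.2, K (eigenbasis e ρ kl.1)⟫_ℂ‖ ^ 2 : ℝ) : EReal)

/-- The pairing `⟨𝓛(ρ), log ρ⟩`. -/
noncomputable def logPairing (e : HilbertBasis ℕ ℂ H) (ν₀ ν₁ : ℝ) (ρ : H →L[ℂ] H) : EReal :=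
  (ν₀ : EReal) * jumpLogPairing e (creation e) ρ + (ν₁ : EReal) * jumpLogPairing e (annihilation e) ρ

/-- The function `Υ(ρ) = q ⟨𝓛(ρ^{1/p}), ρ^{1/q}⟩ + ω tr (ρ a†a) + S(ρ)` of states `ρ`, where `q` is
the Hölder conjugate of `p`; for `p = 1` the first term is `⟨𝓛(ρ), log ρ⟩`. -/
noncomputable def metaFunctional (e : HilbertBasis ℕ ℂ H) (ν₀ ν₁ ω p : ℝ) (ρ : H →L[ℂ] H) : EReal :=
  open scoped Classical in
  (if p = 1 then logPairing e ν₀ ν₁ ρ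
    else (p.conjExponent : EReal) * powerPairing e ν₀ ν₁ p ρ)
  + (ω : EReal) * (meanPhotonNumber e ρ : EReal) + (entropy e ρ : EReal)

/-- `η_th`, the infimum of `Υ` over thermal states. -/
noncomputable def thermalInfimum (e : HilbertBasis ℕ ℂ H) (ν₀ ν₁ ω p : ℝ) : EReal :=
  ⨅ x : Set.Ioo (0 : ℝ) 1, metaFunctional e ν₀ ν₁ ω p (thermalState e x)

end SingleMode

/-! Let `s = 1 / p̂`, and let `λ_k`, `ψ_k` be the eigenvalues and eigenvectors of `ρ`. For `p > 1`
the first term of `Υ` is a sum over jumps `ψ_k → ψ_j` of the cost `c(λ_k, λ_j) = (λ_k - λ_k^{1-s}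
λ_j^s) / s` times the rate `|⟨ψ_j, K ψ_k⟩|²`, for `K = a†` and `K = a`
(`IsState.conjExponent_mul_powerPairing`).

The first reduction replaces `ρ` by the Fock-diagonal state whose spectrum is the decreasing
rearrangement `σ` of `λ`. The entropy does not change, and the mean photon number does not increase,
by Ky Fan's principle (`sum_range_le_sum_rearrangement`). The jump costs do not increase by linear
programming duality: a nonnegative potential `u`, dominated by the spectrum, with `u_k - u_j ≤
c(λ_k, λ_j)` bounds the total cost from below by its net flow. Since `‖a†ψ‖² = ‖aψ‖² + 1`, this
bound is `∑ u` for `a†` and `-∑ u` for `a`. The cost is superadditive along monotone chains, so tail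
sums of nearest-neighbour costs along `σ` are admissible potentials, and they reproduce exactly the
cost of the diagonal state (`tsum_tailSum_le_tsum_jumpCost`).

For decreasing `σ`, subadditivity of the entropy gives `S ≥ ∑ (m+1) σ_m h(σ_{m+1} / σ_m)` with `h`
the binary entropy (`sum_succ_mul_entropy_le`); this is an equality for geometric `σ`. Everything is
now a sum with weights `m + 1` of functions homogeneous of degree one in `(σ_m, σ_{m+1})`. With `x =
σ_{m+1} / σ_m`, the `m`-th one is `σ_m (1 - x) Υ(τ_x) ≥ η (σ_m - σ_{m+1})`, and `∑ (m+1)(σ_m -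
σ_{m+1}) = 1` (`le_of_antitone_of_thermalCost`).

For `p = 1`, the costs increase to the logarithmic cost as `s → 0⁺`, and compactness in `x`
transfers the thermal bound to some `s > 0` at the price of `ε` (`exists_thermalCost_ge`). -/

/-! ### The cost of a jump between two eigenvalues -/

/-- The cost `(x - x^{1-s} y^s) / s` of a jump from eigenvalue `x` to eigenvalue `y`. -/
noncomputable def jumpCost (s x y : ℝ) : ℝ := (x - x ^ (1 - s) * y ^ s) / s

/-- The limit `x (log x - log y)` of `jumpCost s x y` for `s → 0⁺`. -/
noncomputable def logCost (x y : ℝ) : ℝ := x * (Real.log x - Real.log y)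

theorem jumpCost_self {s x : ℝ} (hx : 0 ≤ x) : jumpCost s x x = 0 := by
  rw [jumpCost, ← Real.rpow_add' hx (by simp)]
  simp

theorem jumpCost_zero_left {s y : ℝ} (hs1 : s < 1) : jumpCost s 0 y = 0 := by
  simp [jumpCost, Real.zero_rpow (by linarith : (1 - s) ≠ 0)]

theorem jumpCost_zero_right {s x : ℝ} (hs0 : 0 < s) : jumpCost s x 0 = x / s := by
  simp [jumpCost, Real.zero_rpow hs0.ne']

theorem jumpCost_mul {s c x y : ℝ} (hc : 0 ≤ c) (hx : 0 ≤ x) (hy : 0 ≤ y) :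
    jumpCost s (c * x) (c * y) = c * jumpCost s x y := by
  have h : c ^ (1 - s) * c ^ s = c := by
    rw [← Real.rpow_add' hc (by simp)]; simp
  rw [jumpCost, jumpCost, Real.mul_rpow hc hx, Real.mul_rpow hc hy]
  linear_combination (-(x ^ (1 - s) * y ^ s) / s) * h

theorem logCost_mul {c x y : ℝ} (hc : 0 < c) (hx : 0 < x) (hy : 0 < y) :
    logCost (c * x) (c * y) = c * logCost x y := by
  rw [logCost, logCost, Real.log_mul hc.ne' hx.ne', Real.log_mul hc.ne' hy.ne']
  ring

/-- Weighted AM-GM for `x^{1-s} y^s`. -/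
theorem sub_le_jumpCost {s x y : ℝ} (hs0 : 0 < s) (hs1 : s < 1) (hx : 0 ≤ x) (hy : 0 ≤ y) :
    x - y ≤ jumpCost s x y := by
  have := Real.geom_mean_le_arith_mean2_weighted (w₁ := 1 - s) (w₂ := s) (by linarith) hs0.le hx hy
    (by ring)
  rw [jumpCost, le_div_iff₀ hs0]
  linarith

theorem jumpCost_le {s x y : ℝ} (hs0 : 0 < s) (hx : 0 ≤ x) (hy : 0 ≤ y) :
    jumpCost s x y ≤ x / s := by
  rw [jumpCost]
  gcongr
  have := mul_nonneg (Real.rpow_nonneg hx (1 - s)) (Real.rpow_nonneg hy s)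
  linarith

theorem abs_jumpCost_le {s x y : ℝ} (hs0 : 0 < s) (hs1 : s < 1) (hx : 0 ≤ x) (hy : 0 ≤ y) :
    |jumpCost s x y| ≤ x / s + y := by
  have h1 := sub_le_jumpCost hs0 hs1 hx hy
  have h2 := jumpCost_le hs0 hx hy
  have h3 : 0 ≤ x / s := by positivity
  rw [abs_le]
  constructor <;> linarith

/-- The defect of additivity factors. Both factors have the same sign when `y` lies between `x` and
`z`, whence superadditivity along increasing and decreasing chains. -/
theorem jumpCost_add_sub {s x y z : ℝ} (hy : 0 ≤ y) :
    jumpCost s x z - (jumpCost s x y + jumpCost s y z)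
      = (x ^ (1 - s) - y ^ (1 - s)) * (y ^ s - z ^ s) / s := by
  have h : y ^ (1 - s) * y ^ s = y := by
    rw [← Real.rpow_add' hy (by simp)]; simp
  simp only [jumpCost]
  linear_combination (1 / s) * h

theorem jumpCost_add_le_of_ge {s x y z : ℝ} (hs0 : 0 < s) (hs1 : s < 1) (hz : 0 ≤ z) (hzy : z ≤ y)
    (hyx : y ≤ x) : jumpCost s x y + jumpCost s y z ≤ jumpCost s x z := by
  have hy : 0 ≤ y := hz.trans hzy
  have h1 : y ^ (1 - s) ≤ x ^ (1 - s) := Real.rpow_le_rpow hy hyx (by linarith)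
  have h2 : z ^ s ≤ y ^ s := Real.rpow_le_rpow hz hzy hs0.le
  have := jumpCost_add_sub (s := s) (x := x) (z := z) hy
  have := div_nonneg (mul_nonneg (sub_nonneg.2 h1) (sub_nonneg.2 h2)) hs0.le
  linarith

theorem jumpCost_add_le_of_le {s x y z : ℝ} (hs0 : 0 < s) (hs1 : s < 1) (hx : 0 ≤ x) (hxy : x ≤ y)
    (hyz : y ≤ z) : jumpCost s x y + jumpCost s y z ≤ jumpCost s x z := by
  have hy : 0 ≤ y := hx.trans hxy
  have h1 : x ^ (1 - s) ≤ y ^ (1 - s) := Real.rpow_le_rpow hx hxy (by linarith)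
  have h2 : y ^ s ≤ z ^ s := Real.rpow_le_rpow hy hyz hs0.le
  have := jumpCost_add_sub (s := s) (x := x) (z := z) hy
  have := div_nonneg (mul_nonneg_of_nonpos_of_nonpos (sub_nonpos.2 h1) (sub_nonpos.2 h2)) hs0.le
  linarith

theorem jumpCost_nonneg {s x y : ℝ} (hs0 : 0 < s) (hs1 : s < 1) (hy : 0 ≤ y) (hyx : y ≤ x) :
    0 ≤ jumpCost s x y := by
  linarith [sub_le_jumpCost hs0 hs1 (hy.trans hyx) hy]

theorem jumpCost_nonpos {s x y : ℝ} (hs0 : 0 < s) (hx : 0 ≤ x) (hxy : x ≤ y) :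
    jumpCost s x y ≤ 0 := by
  have h1 : x ^ (1 - s) * x ^ s ≤ x ^ (1 - s) * y ^ s :=
    mul_le_mul_of_nonneg_left (Real.rpow_le_rpow hx hxy hs0.le) (Real.rpow_nonneg hx _)
  rw [← Real.rpow_add' hx (by simp)] at h1
  simp only [sub_add_cancel, Real.rpow_one] at h1
  exact div_nonpos_of_nonpos_of_nonneg (by linarith) hs0.le

/-- The factorization for the round trip `y → x`, back from `x → y`, has factors of opposite sign.
This makes the interval of admissible potential increments nonempty. -/
theorem neg_jumpCost_le {s x y : ℝ} (hs0 : 0 < s) (hs1 : s < 1) (hy : 0 ≤ y) (hyx : y ≤ x) :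
    -jumpCost s y x ≤ jumpCost s x y := by
  have h := jumpCost_add_sub (s := s) (x := x) (y := y) (z := x) hy
  rw [jumpCost_self (hy.trans hyx)] at h
  have h1 : y ^ (1 - s) ≤ x ^ (1 - s) := Real.rpow_le_rpow hy hyx (by linarith)
  have h2 : y ^ s ≤ x ^ s := Real.rpow_le_rpow hy hyx hs0.le
  have := div_nonpos_of_nonpos_of_nonneg
    (mul_nonpos_of_nonneg_of_nonpos (sub_nonneg.2 h1) (sub_nonpos.2 h2)) hs0.le
  linarith

/-- This is `1 + t ≤ exp t` at `t = s (log y - log x)`. -/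
theorem jumpCost_le_logCost {s x y : ℝ} (hs0 : 0 < s) (hx : 0 < x) (hy : 0 < y) :
    jumpCost s x y ≤ logCost x y := by
  have h : x ^ (1 - s) * y ^ s = x * Real.exp (s * (Real.log y - Real.log x)) := by
    rw [Real.rpow_def_of_pos hx, Real.rpow_def_of_pos hy, ← Real.exp_add]
    nth_rw 2 [← Real.exp_log hx]
    rw [← Real.exp_add]
    congr 1; ring
  have h2 := Real.add_one_le_exp (s * (Real.log y - Real.log x))
  rw [jumpCost, logCost, h, div_le_iff₀ hs0]
  nlinarith [mul_le_mul_of_nonneg_left h2 hx.le]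

/-- Homogeneity reduces to `x = 1`, where Bernoulli's inequality for `r^t = (r^s)^{t/s}` applies. -/
theorem jumpCost_antitone {s t x y : ℝ} (hs0 : 0 < s) (hst : s ≤ t) (ht1 : t < 1)
    (hx : 0 ≤ x) (hy : 0 ≤ y) : jumpCost t x y ≤ jumpCost s x y := by
  have ht0 : 0 < t := hs0.trans_le hst
  rcases hx.eq_or_lt with rfl | hx
  · rw [jumpCost_zero_left ht1, jumpCost_zero_left (by linarith)]
  obtain ⟨r, hr, rfl⟩ : ∃ r, 0 ≤ r ∧ y = x * r := ⟨y / x, by positivity, by field_simp⟩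
  have h1 : ∀ u, jumpCost u x (x * r) = x * jumpCost u 1 r := fun u => by
    simpa using jumpCost_mul (s := u) (y := r) hx.le zero_le_one hr
  rw [h1, h1]
  gcongr
  have hv : 0 ≤ r ^ s := Real.rpow_nonneg hr s
  have hb := one_add_mul_self_le_rpow_one_add (s := r ^ s - 1) (by linarith) (p := t / s)
    (by rwa [le_div_iff₀ hs0, one_mul])
  rw [add_sub_cancel, ← Real.rpow_mul hr, mul_div_cancel₀ _ hs0.ne'] at hb
  simp only [jumpCost, Real.one_rpow, one_mul]
  rw [div_le_div_iff₀ ht0 hs0]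
  have : s * (1 + t / s * (r ^ s - 1)) = s + t * (r ^ s - 1) := by field_simp
  nlinarith [mul_le_mul_of_nonneg_left hb hs0.le]

/-- The cost is minus the difference quotient at `0` of `s ↦ x (y / x)^s`. The parameters `1 / (n +
2)` stay strictly inside `(0, 1)`. -/
theorem tendsto_jumpCost {x y : ℝ} (hx : 0 < x) (hy : 0 < y) :
    Filter.Tendsto (fun n : ℕ => jumpCost (1 / (n + 2 : ℝ)) x y) Filter.atTop
      (nhds (logCost x y)) := by
  have hd : HasDerivAt (fun s : ℝ => x * Real.exp (s * (Real.log y - Real.log x)))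
      (-logCost x y) 0 := by
    have := (((hasDerivAt_id (0 : ℝ)).mul_const (Real.log y - Real.log x)).exp).const_mul x
    refine this.congr_deriv ?_
    simp only [id, zero_mul, Real.exp_zero, logCost]
    ring
  have hu : Filter.Tendsto (fun n : ℕ => 1 / (n + 2 : ℝ)) Filter.atTop (nhdsWithin 0 {0}ᶜ) := by
    refine tendsto_nhdsWithin_iff.2 ⟨?_, .of_forall fun n => ?_⟩
    · have := (tendsto_one_div_add_atTop_nhds_zero_nat (𝕜 := ℝ)).comp (Filter.tendsto_add_atTop_nat 1)
      refine this.congr fun n => ?_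
      simp only [Function.comp_apply]; push_cast; ring
    · simp only [Set.mem_compl_iff, Set.mem_singleton_iff]; positivity
  have := (hd.tendsto_slope.comp hu).neg
  rw [neg_neg] at this
  refine this.congr fun n => ?_
  have h : ∀ s : ℝ, x ^ (1 - s) * y ^ s = x * Real.exp (s * (Real.log y - Real.log x)) := by
    intro s
    rw [Real.rpow_def_of_pos hx, Real.rpow_def_of_pos hy, ← Real.exp_add]
    nth_rw 2 [← Real.exp_log hx]
    rw [← Real.exp_add]
    congr 1; ring
  simp only [Function.comp_apply, slope_def_field, jumpCost, h]
  simp only [zero_mul, Real.exp_zero]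
  ring

/-! ### The entropy of a decreasing sequence -/

/-- Gibbs' inequality, one term. -/
theorem sub_le_mul_log_sub {P a b : ℝ} (hP : 0 ≤ P) (ha : P ≤ a) (hb : P ≤ b) :
    P - a * b ≤ P * Real.log P - P * Real.log a - P * Real.log b := by
  rcases hP.eq_or_lt with rfl | hP
  · simp; positivity
  have ha0 := hP.trans_le ha
  have hb0 := hP.trans_le hb
  have h := Real.log_le_sub_one_of_pos (div_pos (mul_pos ha0 hb0) hP)
  rw [Real.log_div (by positivity) hP.ne', Real.log_mul ha0.ne' hb0.ne'] at h
  have h2 := mul_le_mul_of_nonneg_left h hP.le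
  have : P * (a * b / P - 1) = a * b - P := by field_simp
  nlinarith

/-- There are `m + 1` pairs with `j + k = m`; pairs in the square with `j + k ≥ N` contribute
nothing. -/
theorem sum_sum_add_eq_sum_succ_mul (N : ℕ) (F : ℕ → ℝ) (hF : ∀ n, N ≤ n → F n = 0) :
    ∑ j ∈ Finset.range N, ∑ k ∈ Finset.range N, F (j + k)
      = ∑ m ∈ Finset.range N, (m + 1) * F m := by
  have h1 : ∀ j ∈ Finset.range N, ∑ k ∈ Finset.range N, F (j + k)
      = ∑ m ∈ Finset.range N, if j ≤ m then F m else 0 := by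
    intro j hj
    rw [Finset.mem_range] at hj
    rw [← Finset.sum_filter]
    have : Finset.filter (fun m => j ≤ m) (Finset.range N) = Finset.Ico j N := by
      ext; simp; tauto
    rw [this, Finset.sum_Ico_eq_sum_range]
    symm
    refine Finset.sum_subset (fun k hk => ?_) (fun k _ hk => hF _ ?_)
    · simp only [Finset.mem_range] at *; omega
    · simp only [Finset.mem_range] at hk; omega
  rw [Finset.sum_congr rfl h1, Finset.sum_comm]
  refine Finset.sum_congr rfl fun m hm => ?_
  rw [← Finset.sum_filter, Finset.sum_const, nsmul_eq_mul]
  have : Finset.filter (fun j => j ≤ m) (Finset.range N) = Finset.range (m + 1) := by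
    rw [Finset.mem_range] at hm
    ext; simp; omega
  rw [this, Finset.card_range]
  push_cast; ring

/-- Subadditivity of the entropy for the law `P (j, k) = s (j + k) - s (j + k + 1)`, both of whose
marginals are `s`. -/
theorem sum_succ_mul_negMulLog_sub_le {s : ℕ → ℝ} (hs : Antitone s) {N : ℕ}
    (hN : ∀ n, N ≤ n → s n = 0) (hs1 : ∑ m ∈ Finset.range N, s m ≤ 1) :
    ∑ m ∈ Finset.range N, (m + 1) * Real.negMulLog (s m - s (m + 1))
      ≤ 2 * ∑ m ∈ Finset.range N, Real.negMulLog (s m) := by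
  have hs0 : ∀ n, 0 ≤ s n := fun n => by
    rw [← hN (max n N) (le_max_right _ _)]; exact hs (le_max_left _ _)
  have hmarg : ∀ j, ∑ k ∈ Finset.range N, (s (j + k) - s (j + k + 1)) = s j := by
    intro j
    have := Finset.sum_range_sub' (fun k => s (j + k)) N
    simp only [add_zero, hN (j + N) (by omega), sub_zero] at this
    simpa [add_assoc] using this
  have hterm : ∀ j k, (s (j + k) - s (j + k + 1)) - s j * s k
      ≤ -Real.negMulLog (s (j + k) - s (j + k + 1))
        - (s (j + k) - s (j + k + 1)) * Real.log (s j)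
        - (s (k + j) - s (k + j + 1)) * Real.log (s k) := by
    intro j k
    rw [add_comm k j, Real.negMulLog, neg_mul, neg_neg]
    have h0 := hs0 (j + k + 1)
    have h1 : s (j + k) ≤ s j := hs (by omega)
    have h2 : s (j + k) ≤ s k := hs (by omega)
    exact sub_le_mul_log_sub (sub_nonneg.2 (hs (by omega))) (by linarith) (by linarith)
  have hsum := Finset.sum_le_sum fun j (_ : j ∈ Finset.range N) =>
    Finset.sum_le_sum fun k (_ : k ∈ Finset.range N) => hterm j k
  have hA := sum_sum_add_eq_sum_succ_mul N
    (fun n => Real.negMulLog (s n - s (n + 1))) (fun n hn => by simp [hN n hn, hN (n + 1) (by omega)])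
  have hB : ∑ j ∈ Finset.range N, ∑ k ∈ Finset.range N,
      (s (j + k) - s (j + k + 1)) * Real.log (s j) = -∑ m ∈ Finset.range N, Real.negMulLog (s m) := by
    rw [← Finset.sum_neg_distrib]
    refine Finset.sum_congr rfl fun j _ => ?_
    rw [← Finset.sum_mul, hmarg, Real.negMulLog]; ring
  have hC : ∑ j ∈ Finset.range N, ∑ k ∈ Finset.range N,
      (s (k + j) - s (k + j + 1)) * Real.log (s k) = -∑ m ∈ Finset.range N, Real.negMulLog (s m) := by
    rw [Finset.sum_comm]; exact hB
  have hD : ∑ j ∈ Finset.range N, ∑ k ∈ Finset.range N, (s (j + k) - s (j + k + 1))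
      = ∑ m ∈ Finset.range N, s m := Finset.sum_congr rfl fun j _ => hmarg j
  have hE : ∑ j ∈ Finset.range N, ∑ k ∈ Finset.range N, s j * s k
      = (∑ m ∈ Finset.range N, s m) * ∑ m ∈ Finset.range N, s m := (Finset.sum_mul_sum _ _ _ _).symm
  generalize hd : (fun n => s n - s (n + 1)) = d at *
  have hd' : ∀ n, s n - s (n + 1) = d n := fun n => by rw [← hd]
  simp only [hd'] at hsum hA hB hC hD ⊢
  simp only [Finset.sum_sub_distrib, Finset.sum_neg_distrib] at hsum
  rw [hA, hB, hC, hD, hE] at hsum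
  have hS0 : 0 ≤ ∑ m ∈ Finset.range N, s m := Finset.sum_nonneg fun _ _ => hs0 _
  -- With `S` the total mass, summing gives joint entropy `≤ 2 ∑ negMulLog (s m) - S (1 - S)`, and
  -- `0 ≤ S ≤ 1`.
  nlinarith

/-- The summand is `(m+1) s_m` times the binary entropy of `s_{m+1} / s_m`. Abel summation of the
differences of `negMulLog (s m)` yields minus one entropy, and the joint entropy of the law `s (j+k)
- s (j+k+1)` is at most two. -/
theorem sum_succ_mul_entropy_le {s : ℕ → ℝ} (hs : Antitone s) (hs0 : ∀ n, 0 ≤ s n)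
    (hs1 : HasSum s 1) {h : ℝ} (hh : HasSum (fun n => Real.negMulLog (s n)) h) (M : ℕ) :
    ∑ m ∈ Finset.range M, ((m : ℝ) + 1) *
        (Real.negMulLog (s (m + 1)) + Real.negMulLog (s m - s (m + 1)) - Real.negMulLog (s m))
      ≤ h := by
  have hle1 : ∀ n, s n ≤ 1 := fun n => le_hasSum hs1 n fun _ _ => hs0 _
  -- Truncating after index `M`, inclusive, creates the boundary term `(M+1) negMulLog (s M)`, which
  -- is exactly the one left by Abel summation below.
  set t : ℕ → ℝ := fun n => if n ≤ M then s n else 0 with ht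
  have htanti : Antitone t := by
    intro m n hmn
    simp only [ht]
    split_ifs with h1 h2 h2
    · exact hs hmn
    · omega
    · exact hs0 m
    · exact le_rfl
  have htsum : ∀ F : ℝ → ℝ, ∑ m ∈ Finset.range (M + 1), F (t m)
      = ∑ m ∈ Finset.range (M + 1), F (s m) := fun F => by
    refine Finset.sum_congr rfl fun m hm => ?_
    simp only [ht, if_pos (Nat.lt_succ_iff.1 (Finset.mem_range.1 hm))]
  have key := sum_succ_mul_negMulLog_sub_le htanti (N := M + 1)
    (fun n hn => by simp only [ht]; rw [if_neg (by omega)])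
    (by
      rw [htsum fun x => x]
      exact sum_le_hasSum _ (fun _ _ => hs0 _) hs1)
  rw [htsum, Finset.sum_range_succ] at key
  have e1 : ∑ m ∈ Finset.range M, ((m : ℝ) + 1) * Real.negMulLog (t m - t (m + 1))
      = ∑ m ∈ Finset.range M, ((m : ℝ) + 1) * Real.negMulLog (s m - s (m + 1)) := by
    refine Finset.sum_congr rfl fun m hm => ?_
    have := Finset.mem_range.1 hm
    simp only [ht]; rw [if_pos (by omega), if_pos (by omega)]
  have e2 : t M - t (M + 1) = s M := by simp [ht]
  rw [e1, e2] at key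
  have tele : ∀ M : ℕ, ∑ m ∈ Finset.range M, ((m : ℝ) + 1) *
      (Real.negMulLog (s (m + 1)) - Real.negMulLog (s m))
      = (M + 1) * Real.negMulLog (s M) - ∑ m ∈ Finset.range (M + 1), Real.negMulLog (s m) := by
    intro M
    induction M with
    | zero => simp
    | succ M ih =>
      rw [Finset.sum_range_succ, ih, Finset.sum_range_succ _ (M + 1)]
      push_cast; ring
  have hfin : ∑ m ∈ Finset.range (M + 1), Real.negMulLog (s m) ≤ h :=
    sum_le_hasSum _ (fun n _ => Real.negMulLog_nonneg (hs0 n) (hle1 n)) hh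
  have hsplit : ∑ m ∈ Finset.range M, ((m : ℝ) + 1) *
        (Real.negMulLog (s (m + 1)) + Real.negMulLog (s m - s (m + 1)) - Real.negMulLog (s m))
      = ∑ m ∈ Finset.range M, ((m : ℝ) + 1) * (Real.negMulLog (s (m + 1)) - Real.negMulLog (s m))
        + ∑ m ∈ Finset.range M, ((m : ℝ) + 1) * Real.negMulLog (s m - s (m + 1)) := by
    rw [← Finset.sum_add_distrib]
    exact Finset.sum_congr rfl fun _ _ => by ring
  rw [hsplit, tele]
  linarith

/-! ### The inequality for decreasing sequences -/

/-- `(1 - x) Υ(τ_x)`, as a function of the Hölder parameter `s = 1 - 1 / p` and of `x`. -/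
noncomputable def thermalCost (s ν₀ ν₁ ω x : ℝ) : ℝ :=
  ν₀ * jumpCost s 1 x + ν₁ * jumpCost s x 1 + ω * x + Real.binEntropy x

theorem continuous_thermalCost {s : ℝ} (hs0 : 0 < s) (hs1 : s < 1) (ν₀ ν₁ ω : ℝ) :
    Continuous (thermalCost s ν₀ ν₁ ω) := by
  have h1 := Real.continuous_rpow_const (q := s) hs0.le
  have h2 := Real.continuous_rpow_const (q := 1 - s) (by linarith)
  unfold thermalCost jumpCost
  fun_prop

/-- Scaling `(1, r)` to `(x, x r)`: every term is homogeneous of degree one, including the entropy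
bracket, where the multiples of `negMulLog x` cancel. -/
theorem mul_sub_le_of_thermalCost {s ν₀ ν₁ ω η : ℝ} (hs0 : 0 < s) (hs1 : s < 1)
    (hη : ∀ x ∈ Set.Ioo (0 : ℝ) 1, η * (1 - x) ≤ thermalCost s ν₀ ν₁ ω x)
    {x y : ℝ} (hy : 0 ≤ y) (hyx : y ≤ x) :
    η * (x - y) ≤ ν₀ * jumpCost s x y + ν₁ * jumpCost s y x + ω * y
      + (Real.negMulLog y + Real.negMulLog (x - y) - Real.negMulLog x) := by
  have hx : 0 ≤ x := hy.trans hyx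
  rcases hx.eq_or_lt with rfl | hx
  · obtain rfl : y = 0 := le_antisymm hyx hy
    simp [jumpCost_self]
  obtain ⟨r, hr, rfl⟩ : ∃ r, 0 ≤ r ∧ y = x * r := ⟨y / x, by positivity, by field_simp⟩
  have hr1 : r ≤ 1 := by
    by_contra hcon
    nlinarith
  -- The ratio may be `0` (end of the support) or `1` (a plateau), so the bound is extended to the
  -- closed interval by continuity.
  have hcl : r ∈ {t | η * (1 - t) ≤ thermalCost s ν₀ ν₁ ω t} := by
    have hc : IsClosed {t | η * (1 - t) ≤ thermalCost s ν₀ ν₁ ω t} :=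
      isClosed_le (by fun_prop) (continuous_thermalCost hs0 hs1 _ _ _)
    have := closure_minimal (s := Set.Ioo (0 : ℝ) 1) (fun t ht => hη t ht) hc
    rw [closure_Ioo zero_ne_one] at this
    exact this ⟨hr, hr1⟩
  have h1 : jumpCost s x (x * r) = x * jumpCost s 1 r := by
    simpa using jumpCost_mul (s := s) hx.le zero_le_one hr
  have h2 : jumpCost s (x * r) x = x * jumpCost s r 1 := by
    simpa using jumpCost_mul (s := s) hx.le hr zero_le_one
  have h3 : Real.negMulLog (x - x * r) = (1 - r) * Real.negMulLog x + x * Real.negMulLog (1 - r) := by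
    rw [← Real.negMulLog_mul]; ring_nf
  simp only [Set.mem_ofPred_eq, thermalCost,
    Real.binEntropy_eq_negMulLog_add_negMulLog_one_sub] at hcl
  rw [h1, h2, h3, Real.negMulLog_mul]
  have := mul_le_mul_of_nonneg_left hcl hx.le
  linarith

/-- The meta log-Sobolev inequality for diagonal states with decreasing spectrum. -/
theorem le_of_antitone_of_thermalCost {s ν₀ ν₁ ω η : ℝ} (hs0 : 0 < s) (hs1 : s < 1)
    (hη : ∀ x ∈ Set.Ioo (0 : ℝ) 1, η * (1 - x) ≤ thermalCost s ν₀ ν₁ ω x)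
    {σ : ℕ → ℝ} (hσ : Antitone σ) (hσ0 : ∀ n, 0 ≤ σ n) (hσ1 : HasSum σ 1)
    {a b c h : ℝ} (ha : HasSum (fun n : ℕ => ((n : ℝ) + 1) * jumpCost s (σ n) (σ (n + 1))) a)
    (hb : HasSum (fun n : ℕ => ((n : ℝ) + 1) * jumpCost s (σ (n + 1)) (σ n)) b)
    (hc : HasSum (fun n : ℕ => (n : ℝ) * σ n) c) (hh : HasSum (fun n => Real.negMulLog (σ n)) h) :
    η ≤ ν₀ * a + ν₁ * b + ω * c + h := by
  have hc' : HasSum (fun n : ℕ => ((n : ℝ) + 1) * σ (n + 1)) c := by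
    have := (hasSum_nat_add_iff' 1).2 hc
    simpa using this
  -- The sum `∑ (n+1)(σ_n - σ_{n+1})` equals `c + 1 - c = 1`.
  have h1 : HasSum (fun n : ℕ => ((n : ℝ) + 1) * (η * (σ n - σ (n + 1)))) η := by
    have := ((hc.add hσ1).sub hc').mul_left η
    rw [add_sub_cancel_left, mul_one] at this
    rw [show (fun n : ℕ => ((n : ℝ) + 1) * (η * (σ n - σ (n + 1))))
      = fun n : ℕ => η * (n * σ n + σ n - (n + 1) * σ (n + 1)) from funext fun n => by ring]
    exact this
  have h2 := ((ha.mul_left ν₀).add (hb.mul_left ν₁)).add (hc'.mul_left ω)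
  refine le_of_tendsto_of_tendsto h1.tendsto_sum_nat (h2.tendsto_sum_nat.add_const h)
    (.of_forall fun M => ?_)
  have h3 := sum_succ_mul_entropy_le hσ hσ0 hσ1 hh M
  refine le_trans ?_ (add_le_add_right h3 _)
  rw [← Finset.sum_add_distrib]
  refine Finset.sum_le_sum fun m _ => ?_
  have := mul_le_mul_of_nonneg_left
    (mul_sub_le_of_thermalCost hs0 hs1 hη (hσ0 (m + 1)) (hσ (Nat.le_succ m)))
    (by positivity : (0 : ℝ) ≤ m + 1)
  linarith

/-- As `s → 0⁺`, a bound on the limit of the thermal costs is inherited up to `ε`. -/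
theorem exists_thermalCost_ge {ν₀ ν₁ ω η ε : ℝ} (hν₀ : 0 ≤ ν₀) (hν₁ : 0 ≤ ν₁) (hω : 0 ≤ ω)
    (hε : 0 < ε) (hη : ∀ x ∈ Set.Ioo (0 : ℝ) 1, η * (1 - x)
      ≤ ν₀ * logCost 1 x + ν₁ * logCost x 1 + ω * x + Real.binEntropy x) :
    ∃ s, 0 < s ∧ s < 1 ∧ ∀ x ∈ Set.Ioo (0 : ℝ) 1, (η - ε) * (1 - x) ≤ thermalCost s ν₀ ν₁ ω x := by
  by_contra hcon
  push Not at hcon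
  set t : ℕ → ℝ := fun n => 1 / (n + 2 : ℝ) with ht
  have ht0 : ∀ n, 0 < t n := fun n => by simp only [ht]; positivity
  have ht1 : ∀ n, t n < 1 := fun n => by
    simp only [ht]; rw [div_lt_one (by positivity)]; linarith [n.cast_nonneg (α := ℝ)]
  -- For `x > b`, the term `-(1 - x) log (1 - x)` of the binary entropy exceeds `(1 - x)(|η| + ν₁)`.
  -- Hence the bound cannot fail there, whatever the value of `s`.
  set b : ℝ := 1 - Real.exp (-(|η| + ν₁)) with hb
  have hb1 : b < 1 := by simp only [hb]; linarith [Real.exp_pos (-(|η| + ν₁))]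
  -- Points where the bound fails, with a weak inequality to make the sets compact. They are nested
  -- because the cost decreases in `s`, so a single `x` fails for all `n`.
  let C : ℕ → Set ℝ := fun n =>
    Set.Icc 0 b ∩ {x | thermalCost (t n) ν₀ ν₁ ω x ≤ (η - ε) * (1 - x)}
  have hCclosed : ∀ n, IsClosed (C n) := fun n =>
    isClosed_Icc.inter (isClosed_le (continuous_thermalCost (ht0 n) (ht1 n) _ _ _) (by fun_prop))
  have hne : ∀ n, (C n).Nonempty := by
    intro n
    obtain ⟨x, ⟨hx0, hx1⟩, hx⟩ := hcon (t n) (ht0 n) (ht1 n)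
    refine ⟨x, ⟨hx0.le, ?_⟩, hx.le⟩
    by_contra hxb
    push Not at hxb
    have h1 : Real.log (1 - x) ≤ -(|η| + ν₁) := by
      rw [← Real.log_exp (-(|η| + ν₁))]
      exact Real.log_le_log (by linarith) (by simp only [hb] at hxb; linarith)
    have h2 : (1 - x) * (|η| + ν₁) ≤ Real.binEntropy x := by
      rw [Real.binEntropy_eq_negMulLog_add_negMulLog_one_sub, Real.negMulLog, Real.negMulLog]
      have h3 := Real.log_nonpos hx0.le hx1.le
      have h4 : 0 ≤ x * (-Real.log x) := mul_nonneg hx0.le (by linarith)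
      have h5 : (1 - x) * (|η| + ν₁) ≤ (1 - x) * (-Real.log (1 - x)) :=
        mul_le_mul_of_nonneg_left (by linarith) (by linarith)
      linarith
    have h6 := mul_le_mul_of_nonneg_left
      (sub_le_jumpCost (ht0 n) (ht1 n) hx0.le zero_le_one) hν₁
    have h7 := mul_nonneg hν₀ (jumpCost_nonneg (ht0 n) (ht1 n) hx0.le hx1.le)
    have h8 := mul_nonneg hω hx0.le
    have h9 : η * (1 - x) ≤ |η| * (1 - x) :=
      mul_le_mul_of_nonneg_right (le_abs_self η) (by linarith)
    have h10 : 0 < ε * (1 - x) := mul_pos hε (by linarith)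
    simp only [thermalCost] at hx
    linarith
  have hanti : ∀ n, C (n + 1) ⊆ C n := by
    rintro n x ⟨⟨hx0, hx1⟩, hx⟩
    refine ⟨⟨hx0, hx1⟩, le_trans (b := thermalCost (t (n + 1)) ν₀ ν₁ ω x) ?_ hx⟩
    have hle : t (n + 1) ≤ t n := by
      simp only [ht]; push_cast; gcongr; linarith
    have h1 := mul_le_mul_of_nonneg_left
      (jumpCost_antitone (ht0 (n + 1)) hle (ht1 n) zero_le_one hx0) hν₀
    have h2 := mul_le_mul_of_nonneg_left
      (jumpCost_antitone (ht0 (n + 1)) hle (ht1 n) hx0 zero_le_one) hν₁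
    simp only [thermalCost]
    linarith
  obtain ⟨x, hx⟩ := IsCompact.nonempty_iInter_of_sequence_nonempty_isCompact_isClosed C hanti hne
    (isCompact_Icc.of_isClosed_subset (hCclosed 0) Set.inter_subset_left) hCclosed
  rw [Set.mem_iInter] at hx
  have hx0 : 0 ≤ x := (hx 0).1.1
  have hx1 : x < 1 := (hx 0).1.2.trans_lt hb1
  have hxle : ∀ n, thermalCost (t n) ν₀ ν₁ ω x ≤ (η - ε) * (1 - x) := fun n => (hx n).2
  -- At `x = 0` the real logarithm has its default value, so the limit formula is unavailable. There
  -- the cost is `ν₀ / s`: boundedness forces `ν₀ = 0`, and then continuity of the limiting bound at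
  -- `0` gives `η ≤ 0`, against `0 ≤ η - ε`.
  rcases hx0.eq_or_lt with rfl | hx0
  · have hcost : ∀ n, thermalCost (t n) ν₀ ν₁ ω 0 = ν₀ * (n + 2) := fun n => by
      rw [thermalCost, jumpCost_zero_left (ht1 n), jumpCost_zero_right (ht0 n)]
      simp [ht]
    simp only [hcost, sub_zero, mul_one] at hxle
    have hν : ν₀ = 0 := by
      by_contra hν
      have hν' : 0 < ν₀ := lt_of_le_of_ne hν₀ (Ne.symm hν)
      obtain ⟨n, hn⟩ := exists_nat_gt ((η - ε) / ν₀)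
      rw [div_lt_iff₀ hν'] at hn
      nlinarith [hxle n]
    subst hν
    have h0 : 0 ≤ η - ε := by simpa using hxle 0
    have hlim : η ∈ {y : ℝ | y ≤ 0} := by
      have hcont : Continuous fun x : ℝ => ν₁ * (x * Real.log x) + ω * x + Real.binEntropy x
          - η * (1 - x) := by
        have := Real.continuous_mul_log
        fun_prop
      have hcl := closure_minimal (s := Set.Ioo (0 : ℝ) 1)
        (t := {x : ℝ | 0 ≤ ν₁ * (x * Real.log x) + ω * x + Real.binEntropy x - η * (1 - x)})
        (fun x hx => by
          have := hη x hx
          simp only [logCost, Real.log_one, sub_zero, zero_mul, zero_add] at this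
          simp only [Set.mem_ofPred_eq]; linarith) (isClosed_le continuous_const hcont)
      rw [closure_Ioo zero_ne_one] at hcl
      have := hcl ⟨le_rfl, zero_le_one⟩
      simpa using this
    simp only [Set.mem_ofPred_eq] at hlim
    linarith
  · have h1 := hη x ⟨hx0, hx1⟩
    have hlim : Filter.Tendsto (fun n => thermalCost (t n) ν₀ ν₁ ω x) Filter.atTop
        (nhds (ν₀ * logCost 1 x + ν₁ * logCost x 1 + ω * x + Real.binEntropy x)) :=
      ((((tendsto_jumpCost one_pos hx0).const_mul ν₀).add
        ((tendsto_jumpCost hx0 one_pos).const_mul ν₁)).add_const _).add_const _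
    have h2 := le_of_tendsto hlim (.of_forall hxle)
    nlinarith

/-! ### Decreasing rearrangement -/

/-- The rank of `k` counts the indices preceding it when values decrease and ties are broken by
index; the count is finite because `l` tends to `0`. Only positive entries are ranked, since with
infinitely many of them no place is left for zeros. -/
theorem exists_decreasing_rearrangement {l : ℕ → ℝ} (hs : Summable l) :
    ∃ (σ : ℕ → ℝ) (r : ℕ → ℕ), Antitone σ ∧ (∀ n, 0 ≤ σ n) ∧ Set.InjOn r {k | 0 < l k} ∧
      (∀ k, 0 < l k → σ (r k) = l k) ∧ ∀ n, 0 < σ n → ∃ k, 0 < l k ∧ r k = n := by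
  classical
  have hfin : ∀ k, 0 < l k → {j | l k < l j ∨ (l j = l k ∧ j < k)}.Finite := by
    intro k hk
    have h1 : ∀ᶠ j in Filter.cofinite, l j < l k :=
      hs.tendsto_cofinite_zero.eventually_lt_const hk
    refine (Filter.eventually_cofinite.1 h1).subset fun j hj => ?_
    rcases hj with hj | hj
    · exact not_lt.2 hj.le
    · exact not_lt.2 hj.1.ge
  let B : ℕ → Finset ℕ := fun k => if hk : 0 < l k then (hfin k hk).toFinset else ∅
  have hB : ∀ k, 0 < l k → ∀ j, j ∈ B k ↔ l k < l j ∨ (l j = l k ∧ j < k) := by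
    intro k hk j
    simp only [B, dif_pos hk, Set.Finite.mem_toFinset, Set.mem_ofPred_eq]
  have hBpos : ∀ k, 0 < l k → ∀ j ∈ B k, 0 < l j := by
    intro k hk j hj
    rcases (hB k hk j).1 hj with h | h
    · exact hk.trans h
    · rw [h.1]; exact hk
  have hlt : ∀ k, 0 < l k → ∀ j ∈ B k, (B j).card < (B k).card := by
    intro k hk j hj
    have hjp := hBpos k hk j hj
    refine Finset.card_lt_card ((Finset.ssubset_iff_of_subset fun i hi => ?_).2 ⟨j, hj, ?_⟩)
    · rw [hB j hjp] at hi
      rw [hB k hk] at hj ⊢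
      rcases hi with hi | hi <;> rcases hj with hj | hj
      · exact .inl (hj.trans hi)
      · exact .inl (hj.1 ▸ hi)
      · exact .inl (hi.1 ▸ hj)
      · exact .inr ⟨hi.1.trans hj.1, hi.2.trans hj.2⟩
    · rw [hB j hjp]; simp
  have htri : ∀ j k, 0 < l j → 0 < l k → j ≠ k → j ∈ B k ∨ k ∈ B j := by
    intro j k hj hk hne
    rw [hB k hk, hB j hj]
    rcases lt_trichotomy (l j) (l k) with h | h | h
    · exact .inr (.inl h)
    · rcases lt_or_gt_of_ne hne with h' | h'
      · exact .inl (.inr ⟨h, h'⟩)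
      · exact .inr (.inr ⟨h.symm, h'⟩)
    · exact .inl (.inl h)
  let r : ℕ → ℕ := fun k => (B k).card
  have hinj : Set.InjOn r {k | 0 < l k} := by
    intro j hj k hk hjk
    by_contra hne
    rcases htri j k hj hk hne with h | h
    · exact (hlt k hk j h).ne hjk
    · exact (hlt j hj k h).ne hjk.symm
  -- The ranks form an initial segment: the rank maps the predecessors of `k` injectively into
  -- `range (r k)`, a set of the same cardinality.
  have hinit : ∀ k, 0 < l k → ∀ m < r k, ∃ j ∈ B k, r j = m := by
    intro k hk m hm
    have himg : (B k).image r = Finset.range (r k) := by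
      refine Finset.eq_of_subset_of_card_le (fun i hi => ?_) ?_
      · obtain ⟨j, hj, rfl⟩ := Finset.mem_image.1 hi
        exact Finset.mem_range.2 (hlt k hk j hj)
      · rw [Finset.card_image_of_injOn (hinj.mono fun j hj => hBpos k hk j hj), Finset.card_range]
    have : m ∈ (B k).image r := by rw [himg]; exact Finset.mem_range.2 hm
    exact Finset.mem_image.1 this
  let σ : ℕ → ℝ := fun n => if h : ∃ k, 0 < l k ∧ r k = n then l h.choose else 0
  have hσr : ∀ k, 0 < l k → σ (r k) = l k := by
    intro k hk
    have h : ∃ j, 0 < l j ∧ r j = r k := ⟨k, hk, rfl⟩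
    simp only [σ, dif_pos h]
    rw [hinj h.choose_spec.1 hk h.choose_spec.2]
  have hσ0 : ∀ n, 0 ≤ σ n := by
    intro n
    by_cases h : ∃ k, 0 < l k ∧ r k = n
    · obtain ⟨k, hk, rfl⟩ := h
      rw [hσr k hk]; exact hk.le
    · simp only [σ, dif_neg h, le_refl]
  have hσpos : ∀ n, 0 < σ n → ∃ k, 0 < l k ∧ r k = n := by
    intro n hn
    by_contra h
    simp only [σ, dif_neg h, lt_irrefl] at hn
  refine ⟨σ, r, fun m n hmn => ?_, hσ0, hinj, hσr, hσpos⟩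
  rcases (hσ0 n).eq_or_lt with h | h
  · rw [← h]; exact hσ0 m
  obtain ⟨k, hk, rfl⟩ := hσpos n h
  rcases hmn.eq_or_lt with rfl | hlt'
  · exact le_rfl
  obtain ⟨j, hj, rfl⟩ := hinit k hk m hlt'
  rw [hσr k hk, hσr j (hBpos k hk j hj)]
  rcases (hB k hk j).1 hj with h' | h'
  · exact h'.le
  · exact h'.1.ge

theorem hasSum_rearrangement_iff {l σ : ℕ → ℝ} {r : ℕ → ℕ} (hinj : Set.InjOn r {k | 0 < l k})
    (hsurj : ∀ n, 0 < σ n → ∃ k, 0 < l k ∧ r k = n)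
    {F G : ℕ → ℝ} (hF : ∀ n, F n ≠ 0 → 0 < σ n) (hG : ∀ k, G k ≠ 0 → 0 < l k)
    (hFG : ∀ k, 0 < l k → G k = F (r k)) {a : ℝ} : HasSum G a ↔ HasSum F a := by
  refine (hasSum_iff_hasSum_of_ne_zero_bij (fun k : Function.support G => r k) ?_ ?_ ?_).symm
  · intro j k hjk
    exact Subtype.ext (hinj (hG _ j.2) (hG _ k.2) hjk)
  · intro n hn
    obtain ⟨k, hk, rfl⟩ := hsurj n (hF n hn)
    exact ⟨⟨k, by rw [Function.mem_support, hFG k hk]; exact hn⟩, rfl⟩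
  · intro k
    exact (hFG k (hG _ k.2)).symm

/-! ### Duality for jump rates -/

/-- Row sums are known only where `l > 0`; elsewhere the domination makes `v` vanish. The weight `v
= l` gives the dominating double series. -/
theorem hasSum_prod_mul_of_abs_le {l N : ℕ → ℝ} {α : ℕ → ℕ → ℝ} (hl : ∀ k, 0 ≤ l k)
    (hα : ∀ k j, 0 ≤ α k j) (hrow : ∀ k, 0 < l k → HasSum (α k) (N k))
    (hN : Summable fun k => l k * N k) {v : ℕ → ℝ} {C : ℝ} (hv : ∀ k, |v k| ≤ C * l k) :
    HasSum (fun x : ℕ × ℕ => v x.1 * α x.1 x.2) (∑' k, v k * N k) := by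
  have hrow' : ∀ (w : ℕ → ℝ), (∀ k, |w k| ≤ C * l k) → ∀ k, HasSum (fun j => w k * α k j) (w k * N k) := by
    intro w hw k
    rcases (hl k).eq_or_lt with h | h
    · have : w k = 0 := by have := hw k; rw [← h, mul_zero] at this; exact abs_nonpos_iff.1 this
      simp only [this, zero_mul]; exact hasSum_zero
    · exact (hrow k h).mul_left _
  have hrowl : ∀ k, HasSum (fun j => l k * α k j) (l k * N k) := by
    intro k
    rcases (hl k).eq_or_lt with h | h
    · simp only [← h, zero_mul]; exact hasSum_zero
    · exact (hrow k h).mul_left _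
  have hsl : Summable fun x : ℕ × ℕ => l x.1 * α x.1 x.2 := by
    rw [summable_prod_of_nonneg fun x => mul_nonneg (hl _) (hα _ _)]
    exact ⟨fun k => (hrowl k).summable, hN.congr fun k => ((hrowl k).tsum_eq).symm⟩
  have hsv : Summable fun x : ℕ × ℕ => v x.1 * α x.1 x.2 := by
    refine Summable.of_norm_bounded (hsl.mul_left C) fun x => ?_
    rw [norm_mul, Real.norm_eq_abs, Real.norm_eq_abs, abs_of_nonneg (hα _ _), ← mul_assoc]
    exact mul_le_mul_of_nonneg_right (hv _) (hα _ _)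
  have := hsv.hasSum
  rwa [hsv.tsum_prod, tsum_congr fun k => (hrow' v hv k).tsum_eq] at this

/-- Weights on the arrival index are controlled by transposition, through the rows of the adjoint
rates `β`. -/
theorem summable_prod_mul_swap {l N : ℕ → ℝ} {α β : ℕ → ℕ → ℝ} (hl : ∀ k, 0 ≤ l k)
    (hα : ∀ k j, 0 ≤ α k j) (hβ : ∀ k j, 0 ≤ β k j) (hrow : ∀ k, 0 < l k → HasSum (β k) (N k))
    (hN : Summable fun k => l k * N k) (hswap : ∀ k j, 0 < l j → α k j ≤ β j k) {v : ℕ → ℝ} {C : ℝ}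
    (hv : ∀ k, |v k| ≤ C * l k) :
    Summable fun x : ℕ × ℕ => v x.2 * α x.1 x.2 := by
  have h := (hasSum_prod_mul_of_abs_le hl hβ hrow hN hv).summable.norm
  refine Summable.of_norm_bounded ((Equiv.prodComm ℕ ℕ).summable_iff.2 h) fun x => ?_
  simp only [Function.comp_apply, Equiv.prodComm_apply, Prod.fst_swap, Prod.snd_swap, norm_mul]
  rcases (hl x.2).eq_or_lt with h0 | h0
  · have : v x.2 = 0 := by have := hv x.2; rw [← h0, mul_zero] at this; exact abs_nonpos_iff.1 this
    simp [this]
  · rw [Real.norm_of_nonneg (hα _ _), Real.norm_of_nonneg (hβ _ _)]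
    exact mul_le_mul_of_nonneg_left (hswap _ _ h0) (norm_nonneg _)

/-- Weak duality: the net flow of the rates `α` through a potential `u` bounds the total cost. -/
theorem tsum_sub_le_tsum_cost {l N M : ℕ → ℝ} {α β : ℕ → ℕ → ℝ} (hl : ∀ k, 0 ≤ l k)
    (hα : ∀ k j, 0 ≤ α k j) (hβ : ∀ k j, 0 ≤ β k j) (hrow : ∀ k, 0 < l k → HasSum (α k) (N k))
    (hrow' : ∀ k, 0 < l k → HasSum (β k) (M k)) (hN : Summable fun k => l k * N k)
    (hM : Summable fun k => l k * M k) (hswap : ∀ k j, 0 < l j → α k j ≤ β j k) {u : ℕ → ℝ} {C : ℝ}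
    (hu0 : ∀ k, 0 ≤ u k) (hu : ∀ k, u k ≤ C * l k) {c : ℕ → ℕ → ℝ}
    (hc : ∀ k j, u k - u j ≤ c k j) (hsum : Summable fun x : ℕ × ℕ => c x.1 x.2 * α x.1 x.2) :
    ∑' k, u k * N k - ∑' k, u k * M k ≤ ∑' x : ℕ × ℕ, c x.1 x.2 * α x.1 x.2 := by
  have hu' : ∀ k, |u k| ≤ C * l k := fun k => by rw [abs_of_nonneg (hu0 k)]; exact hu k
  have h1 := hasSum_prod_mul_of_abs_le hl hα hrow hN hu'
  have h2 := hasSum_prod_mul_of_abs_le hl hβ hrow' hM hu'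
  have h3 := summable_prod_mul_swap hl hα hβ hrow' hM hswap hu'
  -- The inflow is only bounded by the adjoint rates, as `α` may omit jumps out of the kernel; this
  -- suffices because `u ≥ 0`.
  have h4 : ∑' x : ℕ × ℕ, u x.2 * α x.1 x.2 ≤ ∑' k, u k * M k := by
    rw [← h2.tsum_eq, ← (Equiv.prodComm ℕ ℕ).tsum_eq fun x => u x.1 * β x.1 x.2]
    refine h3.tsum_le_tsum (fun x => ?_) ((Equiv.prodComm ℕ ℕ).summable_iff.2 h2.summable)
    simp only [Equiv.prodComm_apply, Prod.fst_swap, Prod.snd_swap]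
    rcases (hl x.2).eq_or_lt with h0 | h0
    · have : u x.2 = 0 := by
        have := hu' x.2; rw [← h0, mul_zero] at this; exact abs_nonpos_iff.1 this
      simp [this]
    · exact mul_le_mul_of_nonneg_left (hswap _ _ h0) (hu0 _)
  have h5 := (h1.summable.sub h3).tsum_le_tsum (fun x => ?_) hsum
  · rw [h1.summable.tsum_sub h3, h1.tsum_eq] at h5
    linarith
  · rw [← sub_mul]
    exact mul_le_mul_of_nonneg_right (hc _ _) (hα _ _)

theorem summable_jumpCost_mul {s : ℝ} (hs0 : 0 < s) (hs1 : s < 1) {l N M : ℕ → ℝ} {α β : ℕ → ℕ → ℝ}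
    (hl : ∀ k, 0 ≤ l k) (hα : ∀ k j, 0 ≤ α k j) (hβ : ∀ k j, 0 ≤ β k j)
    (hrow : ∀ k, 0 < l k → HasSum (α k) (N k)) (hrow' : ∀ k, 0 < l k → HasSum (β k) (M k))
    (hN : Summable fun k => l k * N k) (hM : Summable fun k => l k * M k)
    (hswap : ∀ k j, 0 < l j → α k j ≤ β j k) :
    Summable fun x : ℕ × ℕ => jumpCost s (l x.1) (l x.2) * α x.1 x.2 := by
  have hv : ∀ k, |l k| ≤ 1 * l k := fun k => by rw [one_mul, abs_of_nonneg (hl k)]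
  have h1 := (hasSum_prod_mul_of_abs_le hl hα hrow hN hv).summable
  have h3 := summable_prod_mul_swap hl hα hβ hrow' hM hswap hv
  refine Summable.of_norm_bounded ((h1.mul_left s⁻¹).add h3) fun x => ?_
  rw [norm_mul, Real.norm_eq_abs, Real.norm_of_nonneg (hα _ _)]
  have := mul_le_mul_of_nonneg_right (abs_jumpCost_le hs0 hs1 (hl x.1) (hl x.2)) (hα x.1 x.2)
  refine this.trans (le_of_eq ?_)
  ring

/-! ### Potentials along a decreasing sequence -/

/-- The potential with increments `d`, vanishing at infinity. -/
noncomputable def tailSum (d : ℕ → ℝ) (n : ℕ) : ℝ := ∑' m, if n ≤ m then d m else 0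

theorem Summable.ite_le {d : ℕ → ℝ} (hd : Summable d) (n : ℕ) :
    Summable fun m => if n ≤ m then d m else 0 := by
  refine (hd.indicator {m | n ≤ m}).congr fun m => ?_
  simp [Set.indicator_apply]

theorem tailSum_sub {d : ℕ → ℝ} (hd : Summable d) {i j : ℕ} (hij : i ≤ j) :
    tailSum d i - tailSum d j = ∑ m ∈ Finset.Ico i j, d m := by
  rw [tailSum, tailSum, ← (hd.ite_le i).tsum_sub (hd.ite_le j), tsum_eq_sum (s := Finset.Ico i j)]
  · refine Finset.sum_congr rfl fun m hm => ?_
    rw [Finset.mem_Ico] at hm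
    rw [if_pos hm.1, if_neg (by omega), sub_zero]
  · intro m hm
    rw [Finset.mem_Ico] at hm
    by_cases h : i ≤ m
    · rw [if_pos h, if_pos (by omega), sub_self]
    · rw [if_neg h, if_neg (by omega), sub_self]

/-- Exchange of summations: `d m` occurs in the tail sums of index `0, …, m`. -/
theorem hasSum_succ_mul_tailSum {d : ℕ → ℝ} (hd0 : ∀ m, 0 ≤ d m) (hd : Summable d)
    (hU : Summable (tailSum d)) : HasSum (fun m : ℕ => ((m : ℝ) + 1) * d m) (∑' n, tailSum d n) := by
  have hs : Summable fun x : ℕ × ℕ => if x.1 ≤ x.2 then d x.2 else 0 := by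
    rw [summable_prod_of_nonneg fun x => by dsimp only; split_ifs; exacts [hd0 _, le_rfl]]
    exact ⟨fun n => hd.ite_le n, hU⟩
  have h1 : ∑' x : ℕ × ℕ, (if x.1 ≤ x.2 then d x.2 else 0) = ∑' n, tailSum d n := hs.tsum_prod
  have h2 : HasSum (fun x : ℕ × ℕ => if x.2 ≤ x.1 then d x.1 else 0) (∑' n, tailSum d n) := by
    have := ((Equiv.prodComm ℕ ℕ).hasSum_iff
      (f := fun x : ℕ × ℕ => if x.1 ≤ x.2 then d x.2 else 0)).2 hs.hasSum
    rw [h1] at this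
    exact this
  refine HasSum.prod_fiberwise (f := fun x : ℕ × ℕ => if x.2 ≤ x.1 then d x.1 else 0) h2 fun m => ?_
  dsimp only
  have : HasSum (fun n => if n ≤ m then d m else 0)
      (∑ n ∈ Finset.range (m + 1), if n ≤ m then d m else 0) :=
    hasSum_sum_of_ne_finset_zero fun n hn => by
      rw [Finset.mem_range] at hn
      rw [if_neg (by omega)]
  convert this using 1
  rw [Finset.sum_congr rfl fun n hn => if_pos (Nat.lt_succ_iff.1 (Finset.mem_range.1 hn))]
  simp

section Potential

variable {s : ℝ} {σ d : ℕ → ℝ}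

/-- Superadditivity upgrades the nearest-neighbour constraint on the potential to all pairs. -/
theorem sum_Ico_le_jumpCost (hs0 : 0 < s) (hs1 : s < 1) (hσ : Antitone σ)
    (hσ0 : ∀ n, 0 ≤ σ n) (hd2 : ∀ m, d m ≤ jumpCost s (σ m) (σ (m + 1))) {i j : ℕ} (hij : i ≤ j) :
    ∑ m ∈ Finset.Ico i j, d m ≤ jumpCost s (σ i) (σ j) := by
  induction j, hij using Nat.le_induction with
  | base => simp [jumpCost_self (hσ0 i)]
  | succ j hij ih =>
    rw [Finset.sum_Ico_succ_top hij]
    have := jumpCost_add_le_of_ge hs0 hs1 (hσ0 (j + 1)) (hσ (Nat.le_succ j)) (hσ hij)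
    linarith [hd2 j]

theorem neg_sum_Ico_le_jumpCost (hs0 : 0 < s) (hs1 : s < 1) (hσ : Antitone σ)
    (hσ0 : ∀ n, 0 ≤ σ n) (hd1 : ∀ m, -d m ≤ jumpCost s (σ (m + 1)) (σ m)) {i j : ℕ} (hij : i ≤ j) :
    -∑ m ∈ Finset.Ico i j, d m ≤ jumpCost s (σ j) (σ i) := by
  induction j, hij using Nat.le_induction with
  | base => simp [jumpCost_self (hσ0 i)]
  | succ j hij ih =>
    rw [Finset.sum_Ico_succ_top hij]
    have := jumpCost_add_le_of_le hs0 hs1 (hσ0 (j + 1)) (hσ (Nat.le_succ j)) (hσ hij)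
    linarith [hd1 j]

theorem summable_of_le_jumpCost (hs0 : 0 < s) (hs1 : s < 1) (hσ : Antitone σ)
    (hσ0 : ∀ n, 0 ≤ σ n) (hd0 : ∀ m, 0 ≤ d m) (hd2 : ∀ m, d m ≤ jumpCost s (σ m) (σ (m + 1))) :
    Summable d := by
  refine summable_of_sum_range_le hd0 (c := σ 0 / s) fun n => ?_
  rw [Finset.range_eq_Ico]
  exact (sum_Ico_le_jumpCost hs0 hs1 hσ hσ0 hd2 n.zero_le).trans (jumpCost_le hs0 (hσ0 0) (hσ0 n))

/-- A tail sum is at most the cost `σ n / s` of a jump to eigenvalue `0`, so the potential can be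
extended by zero to the kernel of the state. -/
theorem tailSum_le (hs0 : 0 < s) (hs1 : s < 1) (hσ : Antitone σ)
    (hσ0 : ∀ n, 0 ≤ σ n) (hd0 : ∀ m, 0 ≤ d m) (hd2 : ∀ m, d m ≤ jumpCost s (σ m) (σ (m + 1)))
    (n : ℕ) : tailSum d n ≤ σ n / s := by
  have hd := summable_of_le_jumpCost hs0 hs1 hσ hσ0 hd0 hd2
  refine le_of_tendsto (hd.ite_le n).hasSum.tendsto_sum_nat
    (Filter.eventually_atTop.2 ⟨n, fun M hM => ?_⟩)
  rw [← Finset.sum_filter]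
  have : Finset.filter (fun m => n ≤ m) (Finset.range M) = Finset.Ico n M := by ext; simp; tauto
  rw [this]
  exact (sum_Ico_le_jumpCost hs0 hs1 hσ hσ0 hd2 hM).trans (jumpCost_le hs0 (hσ0 n) (hσ0 M))

theorem tailSum_nonneg (hd0 : ∀ m, 0 ≤ d m) (n : ℕ) : 0 ≤ tailSum d n :=
  tsum_nonneg fun m => by split_ifs; exacts [hd0 m, le_rfl]

/-- The reduction of the total jump costs to a decreasing spectrum: any increments `d` admissible for
the decreasing rearrangement `σ` of `l` give bounds on the costs of both jump operators. -/
theorem tsum_tailSum_le_tsum_jumpCost (hs0 : 0 < s) (hs1 : s < 1) {l N : ℕ → ℝ} {α β : ℕ → ℕ → ℝ}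
    (hl : ∀ k, 0 ≤ l k) (hls : Summable l) (hα : ∀ k j, 0 ≤ α k j) (hβ : ∀ k j, 0 ≤ β k j)
    (hrow : ∀ k, 0 < l k → HasSum (α k) (N k)) (hrow' : ∀ k, 0 < l k → HasSum (β k) (N k + 1))
    (hN : Summable fun k => l k * N k) (hαβ : ∀ k j, 0 < l j → α k j ≤ β j k)
    (hβα : ∀ k j, 0 < l j → β k j ≤ α j k)
    {r : ℕ → ℕ} (hσ : Antitone σ) (hσ0 : ∀ n, 0 ≤ σ n) (hinj : Set.InjOn r {k | 0 < l k})
    (hσr : ∀ k, 0 < l k → σ (r k) = l k) (hsurj : ∀ n, 0 < σ n → ∃ k, 0 < l k ∧ r k = n)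
    (hd0 : ∀ m, 0 ≤ d m) (hd1 : ∀ m, -d m ≤ jumpCost s (σ (m + 1)) (σ m))
    (hd2 : ∀ m, d m ≤ jumpCost s (σ m) (σ (m + 1))) :
    HasSum (fun m : ℕ => ((m : ℝ) + 1) * d m) (∑' n, tailSum d n) ∧
    ∑' n, tailSum d n ≤ ∑' x : ℕ × ℕ, jumpCost s (l x.1) (l x.2) * β x.1 x.2 ∧
    -∑' n, tailSum d n ≤ ∑' x : ℕ × ℕ, jumpCost s (l x.1) (l x.2) * α x.1 x.2 := by
  have hd := summable_of_le_jumpCost hs0 hs1 hσ hσ0 hd0 hd2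
  have hUle := tailSum_le hs0 hs1 hσ hσ0 hd0 hd2
  have hU0 := tailSum_nonneg hd0
  have hσs : Summable σ := ((hasSum_rearrangement_iff hinj hsurj (F := σ) (G := l)
    (fun n hn => lt_of_le_of_ne (hσ0 n) hn.symm) (fun k hk => lt_of_le_of_ne (hl k) hk.symm)
    fun k hk => (hσr k hk).symm).1 hls.hasSum).summable
  have hUs : Summable (tailSum d) :=
    Summable.of_nonneg_of_le hU0 hUle (hσs.div_const s)
  -- The potential of `k` is that of its rank in `σ`, and zero on the kernel.
  let u : ℕ → ℝ := fun k => if 0 < l k then tailSum d (r k) else 0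
  have hu0 : ∀ k, 0 ≤ u k := fun k => by simp only [u]; split_ifs; exacts [hU0 _, le_rfl]
  have hule : ∀ k, u k ≤ s⁻¹ * l k := by
    intro k
    simp only [u]
    split_ifs with h
    · rw [← hσr k h, ← div_eq_inv_mul]; exact hUle _
    · exact mul_nonneg (inv_nonneg.2 hs0.le) (hl k)
  have husum : HasSum u (∑' n, tailSum d n) := by
    refine (hasSum_rearrangement_iff hinj hsurj (F := tailSum d) (G := u) (fun n hn => ?_)
      (fun k hk => ?_) fun k hk => ?_).2 hUs.hasSum
    · refine lt_of_le_of_ne (hσ0 n) fun h => hn (le_antisymm ?_ (hU0 n))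
      have := hUle n
      rwa [← h, zero_div] at this
    · by_contra h; exact hk (if_neg h)
    · exact if_pos hk
  have hcost : ∀ k j, u k - u j ≤ jumpCost s (l k) (l j) := by
    intro k j
    rcases (hl k).eq_or_lt with hk | hk
    · rw [← hk, jumpCost_zero_left hs1]
      simp only [u, ← hk, lt_irrefl, if_false]
      have := hu0 j
      simp only [u] at this; linarith
    rcases (hl j).eq_or_lt with hj | hj
    · rw [← hj, jumpCost_zero_right hs0]
      simp only [u, ← hj, lt_irrefl, if_false, if_pos hk, sub_zero]
      rw [← hσr k hk]; exact hUle _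
    simp only [u, if_pos hk, if_pos hj]
    rw [← hσr k hk, ← hσr j hj]
    rcases le_total (r k) (r j) with h | h
    · rw [tailSum_sub hd h]
      exact sum_Ico_le_jumpCost hs0 hs1 hσ hσ0 hd2 h
    · rw [← neg_sub, tailSum_sub hd h]
      exact neg_sum_Ico_le_jumpCost hs0 hs1 hσ hσ0 hd1 h
  have hN' : Summable fun k => l k * (N k + 1) :=
    (hN.add hls).congr fun k => by ring
  have huN : Summable fun k => u k * N k := by
    refine Summable.of_norm_bounded (hN.norm.mul_left s⁻¹) fun k => ?_
    rw [norm_mul, norm_mul, Real.norm_of_nonneg (hu0 k), Real.norm_of_nonneg (hl k), ← mul_assoc]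
    exact mul_le_mul_of_nonneg_right (hule k) (norm_nonneg _)
  -- The two row sums differ by `1`, the commutator of `a` and `a†`, so the net flow of `u` is its
  -- plain sum.
  have hdiff : ∑' k, u k * (N k + 1) = ∑' k, u k * N k + ∑' n, tailSum d n := by
    rw [← husum.tsum_eq, ← huN.tsum_add husum.summable]
    exact tsum_congr fun k => by ring
  have hA := tsum_sub_le_tsum_cost hl hα hβ hrow hrow' hN hN' hαβ hu0 hule hcost
    (summable_jumpCost_mul hs0 hs1 hl hα hβ hrow hrow' hN hN' hαβ)
  have hB := tsum_sub_le_tsum_cost hl hβ hα hrow' hrow hN' hN hβα hu0 hule hcost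
    (summable_jumpCost_mul hs0 hs1 hl hβ hα hrow' hrow hN' hN hβα)
  refine ⟨hasSum_succ_mul_tailSum hd0 hd hUs, ?_, ?_⟩ <;> linarith

end Potential

/-! ### The mean photon number of the decreasing rearrangement -/

/-- Ky Fan's principle. The weights `C_k = ∑_{n<N} c n k` lie in `[0, 1]` and have total `N`, so
`l_k C_k ≤ max (l_k - σ_N) 0 + σ_N C_k`; summing over `k` gives the claim. -/
theorem sum_range_le_sum_rearrangement {l σ p : ℕ → ℝ} {r : ℕ → ℕ} {c : ℕ → ℕ → ℝ}
    (hσ : Antitone σ) (hσ0 : ∀ n, 0 ≤ σ n) (hinj : Set.InjOn r {k | 0 < l k})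
    (hσr : ∀ k, 0 < l k → σ (r k) = l k) (hsurj : ∀ n, 0 < σ n → ∃ k, 0 < l k ∧ r k = n)
    (hc : ∀ n k, 0 ≤ c n k) (hrow : ∀ n, HasSum (c n) 1) (hcol : ∀ k, HasSum (fun n => c n k) 1)
    (hp : ∀ n, HasSum (fun k => l k * c n k) (p n)) (N : ℕ) :
    ∑ n ∈ Finset.range N, p n ≤ ∑ n ∈ Finset.range N, σ n := by
  have h1 : HasSum (fun k => l k * ∑ n ∈ Finset.range N, c n k) (∑ n ∈ Finset.range N, p n) := by
    simp only [Finset.mul_sum]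
    exact hasSum_sum fun n _ => hp n
  have h2 : HasSum (fun k => ∑ n ∈ Finset.range N, c n k) N := by
    have := hasSum_sum (s := Finset.range N) fun n _ => hrow n
    simpa using this
  have h3 : HasSum (fun n => max (σ n - σ N) 0) (∑ n ∈ Finset.range N, (σ n - σ N)) := by
    have : HasSum (fun n => max (σ n - σ N) 0) (∑ n ∈ Finset.range N, max (σ n - σ N) 0) :=
      hasSum_sum_of_ne_finset_zero fun n hn => by
        rw [Finset.mem_range, not_lt] at hn
        exact max_eq_right (sub_nonpos.2 (hσ hn))
    rwa [Finset.sum_congr rfl fun n hn =>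
      max_eq_left (sub_nonneg.2 (hσ (Finset.mem_range.1 hn).le))] at this
  have h4 : HasSum (fun k => max (l k - σ N) 0) (∑ n ∈ Finset.range N, (σ n - σ N)) := by
    refine (hasSum_rearrangement_iff hinj hsurj (fun n hn => ?_) (fun k hk => ?_) fun k hk => ?_).2 h3
    · by_contra h
      exact hn (max_eq_right (by linarith [hσ0 N]))
    · by_contra h
      exact hk (max_eq_right (by linarith [hσ0 N]))
    · rw [hσr k hk]
  have h5 := hasSum_le (fun k => ?_) h1 (h4.add (h2.mul_left (σ N)))
  · rw [Finset.sum_sub_distrib] at h5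
    simp only [Finset.sum_const, Finset.card_range, nsmul_eq_mul] at h5
    linarith
  · have hC0 : 0 ≤ ∑ n ∈ Finset.range N, c n k := Finset.sum_nonneg fun n _ => hc n k
    have hC1 : ∑ n ∈ Finset.range N, c n k ≤ 1 := sum_le_hasSum _ (fun n _ => hc n k) (hcol k)
    have h6 := le_max_left (l k - σ N) 0
    have h7 := le_max_right (l k - σ N) 0
    have h8 := mul_le_mul_of_nonneg_right h6 hC0
    have h9 := mul_le_mul_of_nonneg_left hC1 h7
    linarith

/-- Layer cake: the mean is the sum of the tails. Larger partial sums at equal mass therefore mean a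
smaller mean. -/
theorem ENNReal.tsum_natCast_mul (f : ℕ → ℝ≥0∞) :
    ∑' n : ℕ, (n : ℝ≥0∞) * f n = ∑' N, ∑' n, f (n + (N + 1)) := by
  have h1 : ∀ n : ℕ, (n : ℝ≥0∞) * f n = ∑' N, if N < n then f n else 0 := by
    intro n
    rw [tsum_eq_sum (s := Finset.range n) fun N hN => if_neg (by simpa using hN),
      Finset.sum_congr rfl fun N hN => if_pos (Finset.mem_range.1 hN)]
    simp
  have h2 : ∀ N, ∑' n, (if N < n then f n else 0) = ∑' n, f (n + (N + 1)) := by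
    intro N
    rw [← Summable.sum_add_tsum_nat_add' (k := N + 1) ENNReal.summable, Finset.sum_eq_zero, zero_add]
    · exact tsum_congr fun n => if_pos (by omega)
    · intro n hn
      exact if_neg (by simpa [Nat.lt_succ_iff] using hn)
  rw [tsum_congr h1, ENNReal.tsum_comm, tsum_congr h2]

theorem ENNReal.tsum_natCast_mul_le {f g : ℕ → ℝ≥0∞} (hf : ∑' n, f n = 1) (hg : ∑' n, g n = 1)
    (hfg : ∀ N, ∑ n ∈ Finset.range N, g n ≤ ∑ n ∈ Finset.range N, f n) :
    ∑' n : ℕ, (n : ℝ≥0∞) * f n ≤ ∑' n : ℕ, (n : ℝ≥0∞) * g n := by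
  rw [ENNReal.tsum_natCast_mul, ENNReal.tsum_natCast_mul]
  refine ENNReal.tsum_le_tsum fun N => ?_
  have h1 := Summable.sum_add_tsum_nat_add' (f := f) (k := N + 1) ENNReal.summable
  have h2 := Summable.sum_add_tsum_nat_add' (f := g) (k := N + 1) ENNReal.summable
  rw [hf] at h1
  rw [hg, ← h1] at h2
  have hne : ∑ n ∈ Finset.range (N + 1), f n ≠ ∞ :=
    ne_top_of_le_ne_top ENNReal.one_ne_top (h1 ▸ le_self_add)
  refine (ENNReal.add_le_add_iff_left hne).1 ?_
  rw [← h2]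
  exact add_le_add_left (hfg _) _

section Operators

variable {H : Type*} [NormedAddCommGroup H] [InnerProductSpace ℂ H]

/-! ### Annihilation and creation operators -/

theorem HilbertBasis.exists_hasSum_smul {ι : Type*} (e : HilbertBasis ι ℂ H) {c : ι → ℂ}
    (hc : Summable fun n => ‖c n‖ ^ 2) :
    ∃ x, HasSum (fun n => c n • e n) x ∧ ∀ n, ⟪e n, x⟫_ℂ = c n := by
  have hmem : Memℓp c 2 := memℓp_gen (by simpa using hc)
  refine ⟨e.repr.symm ⟨c, hmem⟩, e.hasSum_repr_symm ⟨c, hmem⟩, fun n => ?_⟩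
  rw [← e.repr_apply_apply, LinearIsometryEquiv.apply_symm_apply]

/-- The natural domain of the annihilation and creation operators. -/
def HasFiniteNumber (e : HilbertBasis ℕ ℂ H) (ψ : H) : Prop :=
  Summable fun n : ℕ => (n : ℝ) * ‖⟪e n, ψ⟫_ℂ‖ ^ 2

variable {e : HilbertBasis ℕ ℂ H}

theorem HasFiniteNumber.inner_annihilation {ψ : H} (h : HasFiniteNumber e ψ) (n : ℕ) :
    ⟪e n, annihilation e ψ⟫_ℂ = (Real.sqrt (n + 1) : ℂ) * ⟪e (n + 1), ψ⟫_ℂ := by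
  obtain ⟨x, hx, hxn⟩ := e.exists_hasSum_smul
    (c := fun n => (Real.sqrt (n + 1) : ℂ) * ⟪e (n + 1), ψ⟫_ℂ) (by
      refine ((summable_nat_add_iff 1).2 h).congr fun n => ?_
      rw [norm_mul, mul_pow, Complex.norm_real, Real.norm_of_nonneg (Real.sqrt_nonneg _),
        Real.sq_sqrt (by positivity)]
      push_cast; rfl)
  rw [annihilation, hx.tsum_eq, hxn]

theorem HasFiniteNumber.exists_creation {ψ : H} (h : HasFiniteNumber e ψ) :
    ⟪e 0, creation e ψ⟫_ℂ = 0 ∧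
      ∀ n : ℕ, ⟪e (n + 1), creation e ψ⟫_ℂ = (Real.sqrt (n + 1) : ℂ) * ⟪e n, ψ⟫_ℂ := by
  -- At `n = 0` the truncated index `n - 1` is harmless because `√0 = 0`.
  let c : ℕ → ℂ := fun n => (Real.sqrt n : ℂ) * ⟪e (n - 1), ψ⟫_ℂ
  have hsucc : ∀ n : ℕ, c (n + 1) = (Real.sqrt (n + 1) : ℂ) * ⟪e n, ψ⟫_ℂ := fun n => by simp [c]
  obtain ⟨x, hx, hxn⟩ := e.exists_hasSum_smul (c := c) (by
    refine (summable_nat_add_iff 1).1 ((h.add (hasSum_sq_norm_inner e ψ).summable).congr fun n => ?_)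
    rw [hsucc, norm_mul, mul_pow, Complex.norm_real, Real.norm_of_nonneg (Real.sqrt_nonneg _),
        Real.sq_sqrt (by positivity)]
    ring)
  have hx' : HasSum (fun n => c (n + 1) • e (n + 1)) x := by
    have := (hasSum_nat_add_iff' 1).2 hx
    simpa [c] using this
  have : creation e ψ = x := by
    rw [creation, ← hx'.tsum_eq]
    exact tsum_congr fun n => by rw [hsucc]
  rw [this]
  exact ⟨by rw [hxn]; simp [c], fun n => by rw [hxn, hsucc]⟩

theorem HasFiniteNumber.hasSum_norm_annihilation {ψ : H} (h : HasFiniteNumber e ψ) :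
    HasSum (fun n : ℕ => (n : ℝ) * ‖⟪e n, ψ⟫_ℂ‖ ^ 2) (‖annihilation e ψ‖ ^ 2) := by
  rw [← hasSum_nat_add_iff' 1]
  simp only [Finset.range_one, Finset.sum_singleton, Nat.cast_zero, zero_mul, sub_zero]
  refine HasSum.congr_fun (hasSum_sq_norm_inner e (annihilation e ψ)) fun n => ?_
  rw [h.inner_annihilation, norm_mul, mul_pow, Complex.norm_real,
    Real.norm_of_nonneg (Real.sqrt_nonneg _), Real.sq_sqrt (by positivity)]
  push_cast; rfl

/-- The canonical commutation relation `a a† = a† a + 1` as an identity of quadratic forms. -/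
theorem HasFiniteNumber.norm_creation_sq {ψ : H} (h : HasFiniteNumber e ψ) :
    ‖creation e ψ‖ ^ 2 = ‖annihilation e ψ‖ ^ 2 + ‖ψ‖ ^ 2 := by
  have h1 := (hasSum_nat_add_iff' 1).2 (hasSum_sq_norm_inner e (creation e ψ))
  simp only [Finset.range_one, Finset.sum_singleton, h.exists_creation.1, norm_zero, ne_eq,
    OfNat.ofNat_ne_zero, not_false_eq_true, zero_pow, sub_zero] at h1
  refine h1.unique (HasSum.congr_fun
    (h.hasSum_norm_annihilation.add (hasSum_sq_norm_inner e ψ)) fun n => ?_)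
  rw [h.exists_creation.2, norm_mul, mul_pow, Complex.norm_real,
    Real.norm_of_nonneg (Real.sqrt_nonneg _), Real.sq_sqrt (by positivity)]
  ring

theorem HasFiniteNumber.inner_creation {φ ψ : H} (hφ : HasFiniteNumber e φ)
    (hψ : HasFiniteNumber e ψ) : ⟪φ, creation e ψ⟫_ℂ = ⟪annihilation e φ, ψ⟫_ℂ := by
  have h1 := (hasSum_nat_add_iff' 1).2 (e.hasSum_inner_mul_inner φ (creation e ψ))
  simp only [Finset.range_one, Finset.sum_singleton, hψ.exists_creation.1, mul_zero, sub_zero] at h1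
  refine h1.unique (HasSum.congr_fun (e.hasSum_inner_mul_inner (annihilation e φ) ψ) fun n => ?_)
  rw [hψ.exists_creation.2, ← inner_conj_symm (annihilation e φ), hφ.inner_annihilation, map_mul,
    inner_conj_symm, Complex.conj_ofReal]
  ring

/-- No domain condition is needed, which matters for eigenvectors in the kernel of the state. -/
theorem annihilation_smul (c : ℂ) (ψ : H) : annihilation e (c • ψ) = c • annihilation e ψ := by
  rw [annihilation, annihilation, ← tsum_const_smul'']
  refine tsum_congr fun n => ?_
  rw [inner_smul_right, smul_smul]
  congr 1; ring

theorem creation_smul (c : ℂ) (ψ : H) : creation e (c • ψ) = c • creation e ψ := by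
  rw [creation, creation, ← tsum_const_smul'']
  refine tsum_congr fun n => ?_
  rw [inner_smul_right, smul_smul]
  congr 1; ring

theorem hasFiniteNumber_apply (k : ℕ) : HasFiniteNumber e (e k) := by
  refine (hasSum_sum_of_ne_finset_zero (s := {k}) fun n hn => ?_).summable
  rw [e.orthonormal.2 (by simpa using hn)]
  simp

/-! ### Operators that are diagonal in an orthonormal basis -/

theorem hasSum_inner_apply_of_diagonal {ψ : HilbertBasis ℕ ℂ H} {T : H →L[ℂ] H}
    (hT : (T : H →ₗ[ℂ] H).IsSymmetric) {t : ℕ → ℝ} (ht : ∀ k, T (ψ k) = (t k : ℂ) • ψ k) (x : H) :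
    HasSum (fun k => t k * ‖⟪ψ k, x⟫_ℂ‖ ^ 2) (⟪x, T x⟫_ℂ).re := by
  have h := (ψ.hasSum_inner_mul_inner x (T x)).mapL Complex.reCLM
  refine HasSum.congr_fun h fun k => ?_
  have h1 : ⟪ψ k, T x⟫_ℂ = t k * ⟪ψ k, x⟫_ℂ := by
    have : ⟪T (ψ k), x⟫_ℂ = ⟪ψ k, T x⟫_ℂ := hT (ψ k) x
    rw [← this, ht, inner_smul_left, Complex.conj_ofReal]
  rw [h1, Complex.reCLM_apply, ← inner_conj_symm x, mul_left_comm,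
    ← Complex.normSq_eq_conj_mul_self, ← Complex.ofReal_mul, Complex.ofReal_re,
    Complex.normSq_eq_norm_sq]

/-- Tonelli in `[0, ∞]`: a trace computed in the Fock basis becomes a sum over the eigenbasis
without any summability condition. -/
theorem tsum_ofReal_mul_inner_apply {e ψ : HilbertBasis ℕ ℂ H} {T : H →L[ℂ] H}
    (hT : (T : H →ₗ[ℂ] H).IsSymmetric) {t : ℕ → ℝ} (ht : ∀ k, T (ψ k) = (t k : ℂ) • ψ k)
    (ht0 : ∀ k, 0 ≤ t k) {g : ℕ → ℝ} (hg : ∀ n, 0 ≤ g n) :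
    ∑' n, ENNReal.ofReal (g n * (⟪e n, T (e n)⟫_ℂ).re)
      = ∑' k, ENNReal.ofReal (t k) * ∑' n, ENNReal.ofReal (g n * ‖⟪e n, ψ k⟫_ℂ‖ ^ 2) := by
  simp only [← ENNReal.tsum_mul_left]
  rw [ENNReal.tsum_comm]
  refine tsum_congr fun n => ?_
  have h := (hasSum_inner_apply_of_diagonal hT ht (e n)).mul_left (g n)
  rw [← h.tsum_eq, ENNReal.ofReal_tsum_of_nonneg _ h.summable]
  · refine tsum_congr fun k => ?_
    rw [← ENNReal.ofReal_mul (ht0 k), norm_inner_symm]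
    congr 1; ring
  · exact fun k => mul_nonneg (hg n) (mul_nonneg (ht0 k) (by positivity))

theorem tsum_ofReal_inner_apply {e ψ : HilbertBasis ℕ ℂ H} {T : H →L[ℂ] H}
    (hT : (T : H →ₗ[ℂ] H).IsSymmetric) {t : ℕ → ℝ} (ht : ∀ k, T (ψ k) = (t k : ℂ) • ψ k)
    (ht0 : ∀ k, 0 ≤ t k) :
    ∑' n, ENNReal.ofReal (⟪e n, T (e n)⟫_ℂ).re = ∑' k, ENNReal.ofReal (t k) := by
  have h := tsum_ofReal_mul_inner_apply (e := e) hT ht ht0 (g := fun _ => 1) fun _ => zero_le_one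
  simp only [one_mul] at h
  rw [h]
  refine tsum_congr fun k => ?_
  have h1 := hasSum_sq_norm_inner e (ψ k)
  rw [ψ.orthonormal.1 k, one_pow] at h1
  rw [← ENNReal.ofReal_tsum_of_nonneg (fun n => by positivity) h1.summable, h1.tsum_eq]
  simp

variable [CompleteSpace H]

/-- The continuous functional calculus acts on eigenvectors through the eigenvalue. -/
theorem cfc_apply_of_apply_eq_smul {T : H →L[ℂ] H} (hT : IsSelfAdjoint T) {f : ℝ → ℝ}
    (hf : Continuous f) {v : H} {c : ℝ} (hv : T v = (c : ℂ) • v) :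
    cfc f T v = (f c : ℂ) • v := by
  by_cases hv0 : v = 0
  · simp [hv0]
  have hc : c ∈ spectrum ℝ T := by
    rw [spectrum.mem_iff]
    intro hu
    obtain ⟨S, hS⟩ := hu.exists_left_inv
    have h0 : (algebraMap ℝ (H →L[ℂ] H) c - T) v = 0 := by
      rw [Algebra.algebraMap_eq_smul_one]
      simp [hv]
    have := congrArg (fun A : H →L[ℂ] H => A v) hS
    simp only [mul_apply_eq_comp, h0, map_zero, one_apply_eq_self] at this
    exact hv0 this.symm
  rw [cfc_apply f T hT hf.continuousOn]
  have key : ∀ g : C(spectrum ℝ T, ℝ), cfcHom hT g v = (g ⟨c, hc⟩ : ℂ) • v := by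
    intro g
    have hid : cfcHom hT (.restrict (spectrum ℝ T) (.id ℝ)) v = (c : ℂ) • v := by
      rw [cfcHom_id hT, hv]
    induction g using ContinuousMap.induction_on_of_compact with
    | const r =>
      have : ContinuousMap.const (spectrum ℝ T) r = algebraMap ℝ C(spectrum ℝ T, ℝ) r := rfl
      rw [this, AlgHomClass.commutes, Algebra.algebraMap_eq_smul_one]
      simp
    | id => exact hid
    | star_id => rw [star_trivial]; exact hid
    | add f g hf hg => rw [map_add, add_apply, hf, hg]; simp [add_smul]
    | mul f g hf hg =>
      rw [map_mul, mul_apply_eq_comp, hg, map_smul, hf, smul_smul]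
      simp [mul_comm]
    | frequently f hf =>
      have hcl : IsClosed {g : C(spectrum ℝ T, ℝ) | cfcHom hT g v = (g ⟨c, hc⟩ : ℂ) • v} := by
        refine isClosed_eq ?_ ?_
        · exact (ContinuousLinearMap.apply ℂ H v).continuous.comp (cfcHom_continuous hT)
        · have : Continuous fun g : C(spectrum ℝ T, ℝ) => g ⟨c, hc⟩ :=
            continuous_eval_const _
          fun_prop
      exact hcl.mem_of_frequently_of_tendsto hf Filter.tendsto_id
  exact key _

theorem rpow_apply_of_apply_eq_smul {T : H →L[ℂ] H} (hT : T.IsPositive) {y : ℝ} (hy : 0 ≤ y) {v : H}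
    {c : ℝ} (hv : T v = (c : ℂ) • v) : (T ^ y) v = ((c ^ y : ℝ) : ℂ) • v := by
  rw [CFC.rpow_eq_cfc_real ((ContinuousLinearMap.nonneg_iff_isPositive T).2 hT)]
  exact cfc_apply_of_apply_eq_smul hT.isSelfAdjoint (Real.continuous_rpow_const hy) hv

theorem isPositive_rpow (T : H →L[ℂ] H) (y : ℝ) : (T ^ y).IsPositive :=
  (ContinuousLinearMap.nonneg_iff_isPositive _).1 CFC.rpow_nonneg

end Operators

/-! ### Sums of extended reals -/

theorem extSum_mono {ι : Type*} {f g : ι → EReal} (h : ∀ i, f i ≤ g i) : extSum f ≤ extSum g := by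
  refine EReal.sub_le_sub ?_ ?_
  · exact EReal.coe_ennreal_le_coe_ennreal_iff.2
      (ENNReal.tsum_le_tsum fun i => EReal.toENNReal_le_toENNReal (h i))
  · exact EReal.coe_ennreal_le_coe_ennreal_iff.2
      (ENNReal.tsum_le_tsum fun i => EReal.toENNReal_le_toENNReal (EReal.neg_le_neg_iff.2 (h i)))

theorem extSum_coe {ι : Type*} {f : ι → ℝ} {a : ℝ} (h : HasSum f a) :
    extSum (fun i => (f i : EReal)) = a := by
  have hpart : ∀ g : ι → ℝ, Summable g →
      ((∑' i, (g i : EReal).toENNReal : ℝ≥0∞) : EReal) = ((∑' i, max (g i) 0 : ℝ) : EReal) := by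
    intro g hg
    have hs : Summable fun i => max (g i) 0 := by
      refine Summable.of_norm_bounded hg.norm fun i => ?_
      rw [Real.norm_of_nonneg (le_max_right _ _), Real.norm_eq_abs]
      exact max_le (le_abs_self _) (abs_nonneg _)
    have h1 : ∀ i, (g i : EReal).toENNReal = ENNReal.ofReal (max (g i) 0) := fun i => by
      rw [EReal.real_coe_toENNReal]
      rcases le_total 0 (g i) with hi | hi
      · rw [max_eq_left hi]
      · rw [max_eq_right hi, ENNReal.ofReal_of_nonpos hi, ENNReal.ofReal_zero]
    rw [tsum_congr h1, ← ENNReal.ofReal_tsum_of_nonneg (fun i => le_max_right _ _) hs,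
      EReal.coe_ennreal_ofReal, max_eq_left (tsum_nonneg fun i => le_max_right _ _)]
  have hs : ∀ g : ι → ℝ, Summable g → Summable fun i => max (g i) 0 := by
    intro g hg
    refine Summable.of_norm_bounded hg.norm fun i => ?_
    rw [Real.norm_of_nonneg (le_max_right _ _), Real.norm_eq_abs]
    exact max_le (le_abs_self _) (abs_nonneg _)
  have h2 := hpart (fun i => -f i) h.summable.neg
  simp only [EReal.coe_neg] at h2
  rw [extSum, hpart f h.summable, h2, ← EReal.coe_sub, ← h.tsum_eq,
    ← (hs f h.summable).tsum_sub (hs _ h.summable.neg)]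
  congr 1
  refine tsum_congr fun i => ?_
  rcases le_total 0 (f i) with hi | hi
  · rw [max_eq_left hi, max_eq_right (by linarith), sub_zero]
  · rw [max_eq_right hi, max_eq_left (by linarith)]; ring

/-- The inner sum comes from the sandwich term `K' X` of the Lindbladian, with the rates `β` of the
adjoint operator. Transposing it turns the rates into `α` and completes the out-rates `l k * N k` to
the jump cost. -/
theorem hasSum_pairing {s : ℝ} (hs0 : 0 < s) (hs1 : s < 1) {l N M : ℕ → ℝ} {α β : ℕ → ℕ → ℝ}
    (hl : ∀ k, 0 ≤ l k) (hα : ∀ k j, 0 ≤ α k j) (hβ : ∀ k j, 0 ≤ β k j)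
    (hrow : ∀ k, 0 < l k → HasSum (α k) (N k)) (hrow' : ∀ k, 0 < l k → HasSum (β k) (M k))
    (hN : Summable fun k => l k * N k) (hM : Summable fun k => l k * M k)
    (hαβ : ∀ k j, 0 < l k → 0 < l j → α k j = β j k) (hswap : ∀ k j, 0 < l j → α k j ≤ β j k) :
    HasSum (fun k => l k * N k - l k ^ s * ∑' j, l j ^ (1 - s) * β k j)
      (s * ∑' x : ℕ × ℕ, jumpCost s (l x.1) (l x.2) * α x.1 x.2) := by
  have h1s : 1 - s ≠ 0 := by linarith
  have hJ := summable_jumpCost_mul hs0 hs1 hl hα hβ hrow hrow' hN hM hswap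
  have hv : ∀ k, |l k| ≤ 1 * l k := fun k => by rw [one_mul, abs_of_nonneg (hl k)]
  have h1 := hasSum_prod_mul_of_abs_le hl hα hrow hN hv
  have h2 := h1.sub (hJ.hasSum.mul_left s)
  -- The two rates agree only on the support; off it both sides vanish, because `0 ^ s = 0 ^ (1 - s)
  -- = 0`.
  have h3 : ∀ x : ℕ × ℕ, l x.1 ^ s * l x.2 ^ (1 - s) * β x.1 x.2
      = l x.2 * α x.2 x.1 - s * (jumpCost s (l x.2) (l x.1) * α x.2 x.1) := by
    rintro ⟨k, j⟩
    have : s * jumpCost s (l j) (l k) = l j - l j ^ (1 - s) * l k ^ s := by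
      rw [jumpCost]; field_simp
    dsimp only
    rw [← mul_assoc, this]
    rcases (hl k).eq_or_lt with hk | hk
    · rw [← hk, Real.zero_rpow hs0.ne']; ring
    rcases (hl j).eq_or_lt with hj | hj
    · rw [← hj, Real.zero_rpow h1s]; ring
    rw [hαβ j k hj hk]; ring
  have h4 : HasSum (fun x : ℕ × ℕ => l x.1 ^ s * l x.2 ^ (1 - s) * β x.1 x.2)
      (∑' k, l k * N k - s * ∑' x : ℕ × ℕ, jumpCost s (l x.1) (l x.2) * α x.1 x.2) :=
    HasSum.congr_fun ((Equiv.prodComm ℕ ℕ).hasSum_iff.2 h2) h3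
  have h5 := HasSum.prod_fiberwise h4 fun k => (h4.summable.prod_factor k).hasSum
  have h6 := hN.hasSum.sub h5
  rw [sub_sub_cancel] at h6
  refine HasSum.congr_fun h6 fun k => ?_
  rw [← tsum_mul_left]
  congr 1
  exact tsum_congr fun j => by ring

section States

variable {H : Type*} [NormedAddCommGroup H] [InnerProductSpace ℂ H]
  {e : HilbertBasis ℕ ℂ H} {ρ : H →L[ℂ] H}

/-! ### The spectrum of a state -/

theorem ContinuousLinearMap.IsPositive.isSymmetric_coe {T : H →L[ℂ] H} (hT : T.IsPositive) :
    (T : H →ₗ[ℂ] H).IsSymmetric := hT.isSymmetric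

theorem IsState.eigenvalue_nonneg (hρ : IsState e ρ) (k : ℕ) : 0 ≤ eigenvalue e ρ k :=
  hρ.isPositive.re_inner_nonneg_right _

/-- The weights `|⟨ψ_j, K ψ_k⟩|²` for an eigenbasis `ψ` of `ρ` and `ψ_k` in the support of `ρ`. -/
noncomputable def jumpRate (e : HilbertBasis ℕ ℂ H) (ρ : H →L[ℂ] H) (K : H → H) (k j : ℕ) : ℝ :=
  if 0 < eigenvalue e ρ k then ‖⟪eigenbasis e ρ j, K (eigenbasis e ρ k)⟫_ℂ‖ ^ 2 else 0

theorem jumpRate_nonneg (K : H → H) (k j : ℕ) : 0 ≤ jumpRate e ρ K k j := by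
  rw [jumpRate]; split_ifs <;> positivity

theorem hasSum_jumpRate {K : H → H} {k : ℕ} (hk : 0 < eigenvalue e ρ k) :
    HasSum (jumpRate e ρ K k) (‖K (eigenbasis e ρ k)‖ ^ 2) := by
  refine HasSum.congr_fun (hasSum_sq_norm_inner (eigenbasis e ρ) (K (eigenbasis e ρ k))) fun j => ?_
  rw [jumpRate, if_pos hk]

/-- The total cost `∑ (k, j), jumpCost s λ_k λ_j |⟨ψ_j, K ψ_k⟩|²`. -/
noncomputable def totalCost (e : HilbertBasis ℕ ℂ H) (ρ : H →L[ℂ] H) (s : ℝ) (K : H → H) : ℝ :=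
  ∑' x : ℕ × ℕ, jumpCost s (eigenvalue e ρ x.1) (eigenvalue e ρ x.2) * jumpRate e ρ K x.1 x.2

/-- The costs increase to their limit, the logarithmic pairing. -/
theorem IsState.totalCost_le_jumpLogPairing (hρ : IsState e ρ) {s : ℝ} (hs0 : 0 < s) (hs1 : s < 1)
    {K : H → H} (hsum : Summable fun x : ℕ × ℕ =>
      jumpCost s (eigenvalue e ρ x.1) (eigenvalue e ρ x.2) * jumpRate e ρ K x.1 x.2) :
    ((totalCost e ρ s K : ℝ) : EReal) ≤ jumpLogPairing e K ρ := by
  rw [totalCost, ← extSum_coe hsum.hasSum, jumpLogPairing]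
  refine extSum_mono fun x => ?_
  rcases (hρ.eigenvalue_nonneg x.1).eq_or_lt with hk | hk
  · rw [← hk, jumpCost_zero_left hs1]; simp
  rw [jumpRate, if_pos hk]
  set w := ‖⟪eigenbasis e ρ x.2, K (eigenbasis e ρ x.1)⟫_ℂ‖ ^ 2
  have hw : 0 ≤ w := by positivity
  rw [EReal.coe_mul]
  refine mul_le_mul_of_nonneg_right ?_ (EReal.coe_nonneg.2 hw)
  rcases (hρ.eigenvalue_nonneg x.2).eq_or_lt with hj | hj
  · rw [← hj, ENNReal.ofReal_zero, ENNReal.log_zero, ENNReal.log_ofReal_of_pos hk, EReal.coe_sub_bot,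
      EReal.coe_mul_top_of_pos hk]
    exact le_top
  · rw [ENNReal.log_ofReal_of_pos hk, ENNReal.log_ofReal_of_pos hj, ← EReal.coe_sub, ← EReal.coe_mul]
    exact EReal.coe_le_coe_iff.2 (jumpCost_le_logCost hs0 hk hj)

variable [CompleteSpace H]

theorem IsState.apply_eigenbasis (hρ : IsState e ρ) (k : ℕ) :
    ρ (eigenbasis e ρ k) = (eigenvalue e ρ k : ℂ) • eigenbasis e ρ k := by
  have hψ : IsEigenbasis ρ (eigenbasis e ρ) := by
    have h := hρ.exists_isEigenbasis
    rw [eigenbasis, dif_pos h]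
    exact h.choose_spec
  obtain ⟨c, hc⟩ := hψ k
  have h1 : ⟪eigenbasis e ρ k, ρ (eigenbasis e ρ k)⟫_ℂ = c := by
    rw [hc, inner_smul_right, inner_self_eq_norm_sq_to_K, (eigenbasis e ρ).orthonormal.1]
    simp
  have h2 : (starRingEnd ℂ) c = c := by
    rw [← h1, inner_conj_symm]
    exact hρ.isPositive.isSymmetric_coe _ _
  rw [eigenvalue, h1, Complex.conj_eq_iff_re.1 h2, hc]

theorem IsState.hasSum_eigenvalue (hρ : IsState e ρ) : HasSum (eigenvalue e ρ) 1 := by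
  have h := tsum_ofReal_inner_apply (e := e) hρ.isPositive.isSymmetric_coe hρ.apply_eigenbasis
    hρ.eigenvalue_nonneg
  have h1 : HasSum (fun n => (⟪e n, ρ (e n)⟫_ℂ).re) 1 := by
    simpa using hρ.trace_eq_one.mapL Complex.reCLM
  have h0 : ∀ n, 0 ≤ (⟪e n, ρ (e n)⟫_ℂ).re := fun n => hρ.isPositive.re_inner_nonneg_right _
  rw [← ENNReal.ofReal_tsum_of_nonneg h0 h1.summable, h1.tsum_eq] at h
  have h2 : Summable (eigenvalue e ρ) := by
    have := ENNReal.summable_toReal (f := fun k => ENNReal.ofReal (eigenvalue e ρ k))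
      (by rw [← h]; simp)
    exact this.congr fun k => ENNReal.toReal_ofReal (hρ.eigenvalue_nonneg k)
  rw [← ENNReal.ofReal_tsum_of_nonneg hρ.eigenvalue_nonneg h2] at h
  rw [h2.hasSum_iff]
  exact ((ENNReal.ofReal_eq_ofReal_iff zero_le_one (tsum_nonneg hρ.eigenvalue_nonneg)).1 h).symm

theorem IsState.eigenvalue_le_one (hρ : IsState e ρ) (k : ℕ) : eigenvalue e ρ k ≤ 1 :=
  le_hasSum hρ.hasSum_eigenvalue k fun _ _ => hρ.eigenvalue_nonneg _

theorem IsState.entropy_eq (hρ : IsState e ρ) :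
    entropy e ρ = ∑' k, ENNReal.ofReal (Real.negMulLog (eigenvalue e ρ k)) := by
  have hsa : IsSelfAdjoint (cfc Real.negMulLog ρ) := cfc_predicate _ _
  exact tsum_ofReal_inner_apply (e := e) (ContinuousLinearMap.isSelfAdjoint_iff_isSymmetric.1 hsa)
    (fun k => cfc_apply_of_apply_eq_smul hρ.isPositive.isSelfAdjoint Real.continuous_negMulLog
      (hρ.apply_eigenbasis k))
    fun k => Real.negMulLog_nonneg (hρ.eigenvalue_nonneg k) (hρ.eigenvalue_le_one k)

theorem IsState.meanPhotonNumber_eq (hρ : IsState e ρ) :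
    meanPhotonNumber e ρ = ∑' k, ENNReal.ofReal (eigenvalue e ρ k) *
      ∑' n : ℕ, ENNReal.ofReal (n * ‖⟪e n, eigenbasis e ρ k⟫_ℂ‖ ^ 2) :=
  tsum_ofReal_mul_inner_apply hρ.isPositive.isSymmetric_coe hρ.apply_eigenbasis
    hρ.eigenvalue_nonneg fun n => n.cast_nonneg

/-- An eigenvector of positive weight contributes a finite amount to the mean photon number. -/
theorem IsState.hasFiniteNumber (hρ : IsState e ρ) (hfin : meanPhotonNumber e ρ < ∞) {k : ℕ}
    (hk : 0 < eigenvalue e ρ k) : HasFiniteNumber e (eigenbasis e ρ k) := by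
  rw [hρ.meanPhotonNumber_eq] at hfin
  have h := ENNReal.ne_top_of_tsum_ne_top hfin.ne k
  have h2 : ∑' n : ℕ, ENNReal.ofReal (n * ‖⟪e n, eigenbasis e ρ k⟫_ℂ‖ ^ 2) ≠ ∞ := by
    intro h3
    rw [h3, ENNReal.mul_top (by simpa using hk)] at h
    exact h rfl
  exact (ENNReal.summable_toReal h2).congr fun n => ENNReal.toReal_ofReal (by positivity)

theorem IsState.summable_eigenvalue_mul (hρ : IsState e ρ) (hfin : meanPhotonNumber e ρ < ∞) :
    Summable fun k => eigenvalue e ρ k * ‖annihilation e (eigenbasis e ρ k)‖ ^ 2 := by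
  have hfin' := hfin
  rw [hρ.meanPhotonNumber_eq] at hfin'
  refine (ENNReal.summable_toReal hfin'.ne).congr fun k => ?_
  rw [ENNReal.toReal_mul, ENNReal.toReal_ofReal (hρ.eigenvalue_nonneg k)]
  rcases (hρ.eigenvalue_nonneg k).eq_or_lt with h | h
  · rw [← h, zero_mul, zero_mul]
  have h1 := (hρ.hasFiniteNumber hfin h).hasSum_norm_annihilation
  rw [← ENNReal.ofReal_tsum_of_nonneg (fun n => by positivity) h1.summable, h1.tsum_eq,
    ENNReal.toReal_ofReal (by positivity)]

theorem IsState.hasSum_jumpRate_creation (hρ : IsState e ρ) (hfin : meanPhotonNumber e ρ < ∞) {k : ℕ}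
    (hk : 0 < eigenvalue e ρ k) :
    HasSum (jumpRate e ρ (creation e) k) (‖annihilation e (eigenbasis e ρ k)‖ ^ 2 + 1) := by
  have := hasSum_jumpRate (K := creation e) hk
  rwa [(hρ.hasFiniteNumber hfin hk).norm_creation_sq, (eigenbasis e ρ).orthonormal.1, one_pow] at this

theorem IsState.jumpRate_symm (hρ : IsState e ρ) (hfin : meanPhotonNumber e ρ < ∞) {k j : ℕ}
    (hk : 0 < eigenvalue e ρ k) (hj : 0 < eigenvalue e ρ j) :
    jumpRate e ρ (annihilation e) k j = jumpRate e ρ (creation e) j k := by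
  rw [jumpRate, jumpRate, if_pos hk, if_pos hj,
    (hρ.hasFiniteNumber hfin hk).inner_creation (hρ.hasFiniteNumber hfin hj), norm_inner_symm]

/-- Rates out of the kernel are set to zero, so beyond the support of `ρ` adjointness survives only
as an inequality. -/
theorem IsState.jumpRate_annihilation_le (hρ : IsState e ρ) (hfin : meanPhotonNumber e ρ < ∞)
    (k j : ℕ) (hj : 0 < eigenvalue e ρ j) :
    jumpRate e ρ (annihilation e) k j ≤ jumpRate e ρ (creation e) j k := by
  by_cases hk : 0 < eigenvalue e ρ k
  · exact (hρ.jumpRate_symm hfin hk hj).le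
  · rw [jumpRate, if_neg hk]; exact jumpRate_nonneg _ _ _

theorem IsState.jumpRate_creation_le (hρ : IsState e ρ) (hfin : meanPhotonNumber e ρ < ∞)
    (k j : ℕ) (hj : 0 < eigenvalue e ρ j) :
    jumpRate e ρ (creation e) k j ≤ jumpRate e ρ (annihilation e) j k := by
  by_cases hk : 0 < eigenvalue e ρ k
  · exact (hρ.jumpRate_symm hfin hj hk).ge
  · rw [jumpRate, if_neg hk]; exact jumpRate_nonneg _ _ _

theorem IsState.summable_eigenvalue_mul_add_one (hρ : IsState e ρ)
    (hfin : meanPhotonNumber e ρ < ∞) :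
    Summable fun k => eigenvalue e ρ k * (‖annihilation e (eigenbasis e ρ k)‖ ^ 2 + 1) :=
  ((hρ.summable_eigenvalue_mul hfin).add hρ.hasSum_eigenvalue.summable).congr fun k => by ring

/-! ### The Dirichlet form in an eigenbasis -/

/-- Each anticommutator term contributes half of `λ^s λ^{1-s} = λ` times `‖Kψ‖²`; the sandwich term
is expanded in the eigenbasis. Here `1 - s` plays the role of `1 / p`. -/
theorem jumpForm_eigenbasis (hρ : IsState e ρ) {s : ℝ} (hs0 : 0 < s) (hs1 : s < 1) {K K' : H → H}
    (hK : ∀ (c : ℂ) v, K (c • v) = c • K v) (hK' : ∀ (c : ℂ) v, K' (c • v) = c • K' v) (k : ℕ) :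
    (jumpForm K K' (ρ ^ (1 - s)) ((ρ ^ s) (eigenbasis e ρ k)) (eigenbasis e ρ k)).re
      = eigenvalue e ρ k * ‖K (eigenbasis e ρ k)‖ ^ 2
        - eigenvalue e ρ k ^ s * ∑' j, eigenvalue e ρ j ^ (1 - s) * jumpRate e ρ K' k j := by
  set ψ := eigenbasis e ρ
  set l := eigenvalue e ρ
  have hl : 0 ≤ l k := hρ.eigenvalue_nonneg k
  have hX : ∀ j, (ρ ^ (1 - s)) (ψ j) = ((l j ^ (1 - s) : ℝ) : ℂ) • ψ j := fun j =>
    rpow_apply_of_apply_eq_smul hρ.isPositive (by linarith) (hρ.apply_eigenbasis j)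
  have hY : (ρ ^ s) (ψ k) = ((l k ^ s : ℝ) : ℂ) • ψ k :=
    rpow_apply_of_apply_eq_smul hρ.isPositive hs0.le (hρ.apply_eigenbasis k)
  have hXpos := isPositive_rpow ρ (1 - s)
  have hadj : ContinuousLinearMap.adjoint (ρ ^ (1 - s)) = ρ ^ (1 - s) :=
    hXpos.isSelfAdjoint.adjoint_eq
  have hsum := hasSum_inner_apply_of_diagonal hXpos.isSymmetric_coe hX (K' (ψ k))
  have hmul : l k ^ s * l k ^ (1 - s) = l k := by
    rw [← Real.rpow_add' hl (by simp)]; simp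
  have hself : ⟪K (ψ k), K (ψ k)⟫_ℂ = ((‖K (ψ k)‖ ^ 2 : ℝ) : ℂ) := by
    rw [inner_self_eq_norm_sq_to_K]; push_cast; rfl
  rw [jumpForm, hadj, hY, map_smul, hX, smul_smul, hK, hK, hK, hK']
  simp only [inner_smul_left, inner_smul_right, map_mul, Complex.conj_ofReal, hself]
  rw [Complex.sub_re, Complex.re_ofReal_mul]
  congr 1
  · rw [show (1 / 2 : ℂ) = ((1 / 2 : ℝ) : ℂ) by push_cast; rfl]
    simp only [← Complex.ofReal_mul, ← Complex.ofReal_add, Complex.ofReal_re]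
    linear_combination ‖K (ψ k)‖ ^ 2 * hmul
  -- For eigenvalue zero, `ψ k` may lie outside the domain of `K'`, but the factor `λ^s` vanishes.
  · rcases hl.eq_or_lt with h | h
    · have : l k = 0 := h.symm
      rw [this, Real.zero_rpow hs0.ne', zero_mul, zero_mul]
    · congr 1
      rw [← hsum.tsum_eq]
      exact tsum_congr fun j => by rw [jumpRate, if_pos h]

theorem IsState.conjExponent_mul_powerPairing (hρ : IsState e ρ) (hfin : meanPhotonNumber e ρ < ∞)
    {ν₀ ν₁ p : ℝ} (hp : 1 < p) :
    (p.conjExponent : EReal) * powerPairing e ν₀ ν₁ p ρ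
      = ((ν₀ * totalCost e ρ (1 / p.conjExponent) (creation e)
        + ν₁ * totalCost e ρ (1 / p.conjExponent) (annihilation e) : ℝ) : EReal) := by
  have hq : p.HolderConjugate p.conjExponent := Real.HolderConjugate.conjExponent hp
  set q := p.conjExponent
  have hq0 : 0 < q := hq.symm.pos
  set s := 1 / q with hs
  have hs0 : 0 < s := by positivity
  have hps : 1 / p = 1 - s := by
    have := hq.inv_add_inv_eq_one
    rw [hs, one_div, one_div]; linarith
  have hs1 : s < 1 := by
    have : 0 < 1 / p := by have := hq.pos; positivity
    linarith
  have hα := hasSum_pairing hs0 hs1 hρ.eigenvalue_nonneg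
    (jumpRate_nonneg (e := e) (ρ := ρ) (annihilation e)) (jumpRate_nonneg (creation e))
    (fun k hk => hasSum_jumpRate hk) (fun k hk => hρ.hasSum_jumpRate_creation hfin hk)
    (hρ.summable_eigenvalue_mul hfin) (hρ.summable_eigenvalue_mul_add_one hfin)
    (fun k j hk hj => hρ.jumpRate_symm hfin hk hj) (hρ.jumpRate_annihilation_le hfin)
  have hβ := hasSum_pairing hs0 hs1 hρ.eigenvalue_nonneg
    (jumpRate_nonneg (e := e) (ρ := ρ) (creation e)) (jumpRate_nonneg (annihilation e))
    (fun k hk => hρ.hasSum_jumpRate_creation hfin hk) (fun k hk => hasSum_jumpRate hk)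
    (hρ.summable_eigenvalue_mul_add_one hfin) (hρ.summable_eigenvalue_mul hfin)
    (fun k j hk hj => (hρ.jumpRate_symm hfin hj hk).symm) (hρ.jumpRate_creation_le hfin)
  have hsum := (hβ.mul_left ν₀).add (hα.mul_left ν₁)
  rw [powerPairing, hps, extSum_coe (HasSum.congr_fun hsum fun k => ?_), ← EReal.coe_mul]
  · congr 1
    simp only [totalCost, hs]
    field_simp
  · rw [lindbladForm, Complex.add_re, Complex.re_ofReal_mul, Complex.re_ofReal_mul,
      jumpForm_eigenbasis hρ hs0 hs1 creation_smul annihilation_smul,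
      jumpForm_eigenbasis hρ hs0 hs1 annihilation_smul creation_smul]
    rcases (hρ.eigenvalue_nonneg k).eq_or_lt with h | h
    · simp only [← h, zero_mul]
    · rw [(hρ.hasFiniteNumber hfin h).norm_creation_sq, (eigenbasis e ρ).orthonormal.1, one_pow]

/-! ### The inequality for states -/

theorem IsState.le_of_thermalCost (hρ : IsState e ρ) (hfin : meanPhotonNumber e ρ < ∞)
    {s ν₀ ν₁ ω η : ℝ} (hs0 : 0 < s) (hs1 : s < 1) (hν₀ : 0 ≤ ν₀) (hν₁ : 0 ≤ ν₁) (hω : 0 ≤ ω)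
    (hη : ∀ x ∈ Set.Ioo (0 : ℝ) 1, η * (1 - x) ≤ thermalCost s ν₀ ν₁ ω x) :
    (η : EReal) ≤ ((ν₀ * totalCost e ρ s (creation e) + ν₁ * totalCost e ρ s (annihilation e) : ℝ)
      : EReal) + (ω : EReal) * (meanPhotonNumber e ρ : EReal) + (entropy e ρ : EReal) := by
  obtain ⟨m, hm0, hm⟩ : ∃ m : ℝ, 0 ≤ m ∧ meanPhotonNumber e ρ = ENNReal.ofReal m :=
    ⟨_, ENNReal.toReal_nonneg, (ENNReal.ofReal_toReal hfin.ne).symm⟩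
  have hm' : (meanPhotonNumber e ρ : EReal) = (m : EReal) := by
    rw [hm, EReal.coe_ennreal_ofReal, max_eq_left hm0]
  rw [hm', ← EReal.coe_mul, ← EReal.coe_add]
  -- The other terms are real, so infinite entropy makes the right-hand side `⊤`.
  by_cases hS : entropy e ρ = ∞
  · rw [hS, EReal.coe_ennreal_top, EReal.coe_add_top]
    exact le_top
  set l := eigenvalue e ρ with hl
  have hL0 : ∀ k, 0 ≤ Real.negMulLog (l k) := fun k =>
    Real.negMulLog_nonneg (hρ.eigenvalue_nonneg k) (hρ.eigenvalue_le_one k)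
  have hL : Summable fun k => Real.negMulLog (l k) := by
    rw [hρ.entropy_eq] at hS
    exact (ENNReal.summable_toReal hS).congr fun k => ENNReal.toReal_ofReal (hL0 k)
  obtain ⟨h, hh⟩ := hL
  have hS' : (entropy e ρ : EReal) = (h : EReal) := by
    rw [hρ.entropy_eq, ← ENNReal.ofReal_tsum_of_nonneg hL0 hh.summable, hh.tsum_eq,
      EReal.coe_ennreal_ofReal, max_eq_left (hh.nonneg hL0)]
  rw [hS', ← EReal.coe_add]
  refine EReal.coe_le_coe_iff.2 ?_
  obtain ⟨σ, r, hσ, hσ0, hinj, hσr, hsurj⟩ :=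
    exists_decreasing_rearrangement hρ.hasSum_eigenvalue.summable
  have hσ1 : HasSum σ 1 := (hasSum_rearrangement_iff hinj hsurj (F := σ) (G := l)
    (fun n hn => lt_of_le_of_ne (hσ0 n) hn.symm)
    (fun k hk => lt_of_le_of_ne (hρ.eigenvalue_nonneg k) hk.symm)
    fun k hk => (hσr k hk).symm).1 hρ.hasSum_eigenvalue
  have hσh : HasSum (fun n => Real.negMulLog (σ n)) h := by
    refine (hasSum_rearrangement_iff hinj hsurj (fun n hn => lt_of_le_of_ne (hσ0 n) fun h0 => hn ?_)
      (fun k hk => lt_of_le_of_ne (hρ.eigenvalue_nonneg k) fun h0 => hk ?_) fun k hk => ?_).1 hh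
    · rw [← h0, Real.negMulLog_zero]
    · rw [hl, ← h0, Real.negMulLog_zero]
    · rw [hσr k hk]
  obtain ⟨c, hc, hcm⟩ : ∃ c, HasSum (fun n : ℕ => (n : ℝ) * σ n) c ∧ c ≤ m := by
    have hp0 : ∀ n, 0 ≤ (⟪e n, ρ (e n)⟫_ℂ).re := fun n => hρ.isPositive.re_inner_nonneg_right _
    have hp1 : HasSum (fun n => (⟪e n, ρ (e n)⟫_ℂ).re) 1 := by
      simpa using hρ.trace_eq_one.mapL Complex.reCLM
    -- The matrix `|⟨ψ_k, e_n⟩|²` is doubly stochastic by Parseval in each basis.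
    have hkf := sum_range_le_sum_rearrangement (l := l) (p := fun n => (⟪e n, ρ (e n)⟫_ℂ).re)
      (c := fun n k => ‖⟪eigenbasis e ρ k, e n⟫_ℂ‖ ^ 2) hσ hσ0 hinj hσr hsurj
      (fun n k => by positivity)
      (fun n => by
        have := hasSum_sq_norm_inner (eigenbasis e ρ) (e n)
        rwa [e.orthonormal.1, one_pow] at this)
      (fun k => by
        have := hasSum_sq_norm_inner e (eigenbasis e ρ k)
        rw [(eigenbasis e ρ).orthonormal.1, one_pow] at this
        exact HasSum.congr_fun this fun n => by rw [norm_inner_symm])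
      (fun n => hasSum_inner_apply_of_diagonal hρ.isPositive.isSymmetric_coe hρ.apply_eigenbasis _)
    have hle := ENNReal.tsum_natCast_mul_le (f := fun n => ENNReal.ofReal (σ n))
      (g := fun n => ENNReal.ofReal (⟪e n, ρ (e n)⟫_ℂ).re)
      (by rw [← ENNReal.ofReal_tsum_of_nonneg hσ0 hσ1.summable, hσ1.tsum_eq, ENNReal.ofReal_one])
      (by rw [← ENNReal.ofReal_tsum_of_nonneg hp0 hp1.summable, hp1.tsum_eq, ENNReal.ofReal_one])
      (fun N => by
        rw [← ENNReal.ofReal_sum_of_nonneg fun n _ => hσ0 n,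
          ← ENNReal.ofReal_sum_of_nonneg fun n _ => hp0 n]
        exact ENNReal.ofReal_le_ofReal (hkf N))
    have hmul : ∀ (n : ℕ) (x : ℝ), (n : ℝ≥0∞) * ENNReal.ofReal x = ENNReal.ofReal (n * x) :=
      fun n x => by rw [ENNReal.ofReal_mul n.cast_nonneg, ENNReal.ofReal_natCast]
    simp only [hmul] at hle
    change _ ≤ meanPhotonNumber e ρ at hle
    have hnn : ∀ n : ℕ, 0 ≤ (n : ℝ) * σ n := fun n => mul_nonneg n.cast_nonneg (hσ0 n)
    have hs : Summable fun n : ℕ => (n : ℝ) * σ n :=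
      (ENNReal.summable_toReal (hle.trans_lt hfin).ne).congr fun n => ENNReal.toReal_ofReal (hnn n)
    refine ⟨_, hs.hasSum, ?_⟩
    rw [hm, ← ENNReal.ofReal_tsum_of_nonneg hnn hs] at hle
    exact (ENNReal.ofReal_le_ofReal_iff hm0).1 hle
  have hred : ∀ d : ℕ → ℝ, _ → _ → _ → _ := fun d =>
    tsum_tailSum_le_tsum_jumpCost (d := d) hs0 hs1 hρ.eigenvalue_nonneg
      hρ.hasSum_eigenvalue.summable (jumpRate_nonneg (e := e) (ρ := ρ) (annihilation e))
      (jumpRate_nonneg (creation e)) (fun k hk => hasSum_jumpRate hk)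
      (fun k hk => hρ.hasSum_jumpRate_creation hfin hk) (hρ.summable_eigenvalue_mul hfin)
      (hρ.jumpRate_annihilation_le hfin) (hρ.jumpRate_creation_le hfin) hσ hσ0 hinj hσr hsurj
  have hle : ∀ m : ℕ, σ (m + 1) ≤ σ m := fun m => hσ (Nat.le_succ m)
  -- Increments are admissible between `-c(σ_{m+1}, σ_m)` and `c(σ_m, σ_{m+1})`. The upper end is
  -- optimal for `a†`, the lower end for `a`.
  obtain ⟨ha, ha', -⟩ := hred (fun m => jumpCost s (σ m) (σ (m + 1)))
    (fun m => jumpCost_nonneg hs0 hs1 (hσ0 _) (hle m))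
    (fun m => neg_le.1 (neg_jumpCost_le hs0 hs1 (hσ0 _) (hle m))) (fun m => le_rfl)
  obtain ⟨hb, -, hb'⟩ := hred (fun m => -jumpCost s (σ (m + 1)) (σ m))
    (fun m => neg_nonneg.2 (jumpCost_nonpos hs0 (hσ0 _) (hle m)))
    (fun m => (neg_neg _).le) (fun m => neg_jumpCost_le hs0 hs1 (hσ0 _) (hle m))
  have hbn := hb.neg
  simp only [mul_neg, neg_neg] at hbn
  have key := le_of_antitone_of_thermalCost hs0 hs1 hη hσ hσ0 hσ1 ha hbn hc hσh
  have h1 := mul_le_mul_of_nonneg_left ha' hν₀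
  have h2 := mul_le_mul_of_nonneg_left hb' hν₁
  have h3 := mul_le_mul_of_nonneg_left hcm hω
  simp only [totalCost]
  linarith

end States

section Thermal

variable {H : Type*} [NormedAddCommGroup H] [InnerProductSpace ℂ H]
  {e : HilbertBasis ℕ ℂ H} {x : ℝ}

/-! ### Thermal states -/

theorem inner_creation_basis (m n : ℕ) :
    ‖⟪e n, creation e (e m)⟫_ℂ‖ ^ 2 = if n = m + 1 then (m : ℝ) + 1 else 0 := by
  have h := (hasFiniteNumber_apply (e := e) m).exists_creation
  cases n with
  | zero => rw [h.1]; simp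
  | succ n =>
    rw [h.2, orthonormal_iff_ite.1 e.orthonormal]
    by_cases hn : n = m
    · subst hn
      rw [if_pos rfl, if_pos rfl, mul_one, Complex.norm_real,
        Real.norm_of_nonneg (Real.sqrt_nonneg _), Real.sq_sqrt (by positivity)]
    · rw [if_neg hn, if_neg (by omega)]; simp

theorem inner_annihilation_basis (m n : ℕ) :
    ‖⟪e n, annihilation e (e m)⟫_ℂ‖ ^ 2 = if m = n + 1 then (n : ℝ) + 1 else 0 := by
  rw [norm_inner_symm, ← (hasFiniteNumber_apply m).inner_creation (hasFiniteNumber_apply n),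
    inner_creation_basis]

theorem hasSum_succ_mul_thermal (hx0 : 0 < x) (hx1 : x < 1) :
    HasSum (fun n : ℕ => ((n : ℝ) + 1) * ((1 - x) * x ^ n)) (1 / (1 - x)) := by
  have hnorm : ‖x‖ < 1 := by rwa [Real.norm_of_nonneg hx0.le]
  have h := ((hasSum_coe_mul_geometric_of_norm_lt_one hnorm).add
    (hasSum_geometric_of_lt_one hx0.le hx1)).mul_left (1 - x)
  have h1 : 1 - x ≠ 0 := by linarith
  rw [show 1 / (1 - x) = (1 - x) * (x / (1 - x) ^ 2 + (1 - x)⁻¹) by field_simp; ring]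
  exact HasSum.congr_fun h fun n => by ring

theorem hasSum_negMulLog_thermal (hx0 : 0 < x) (hx1 : x < 1) :
    HasSum (fun n : ℕ => Real.negMulLog ((1 - x) * x ^ n)) (Real.binEntropy x / (1 - x)) := by
  have hnorm : ‖x‖ < 1 := by rwa [Real.norm_of_nonneg hx0.le]
  have h := ((hasSum_geometric_of_lt_one hx0.le hx1).mul_right (Real.negMulLog (1 - x))).add
    ((hasSum_coe_mul_geometric_of_norm_lt_one hnorm).mul_left ((1 - x) * (-Real.log x)))
  have h1 : 1 - x ≠ 0 := by linarith
  rw [show Real.binEntropy x / (1 - x) = (1 - x)⁻¹ * Real.negMulLog (1 - x)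
      + (1 - x) * (-Real.log x) * (x / (1 - x) ^ 2) by
    rw [Real.binEntropy_eq_negMulLog_add_negMulLog_one_sub, Real.negMulLog]; field_simp; ring]
  refine HasSum.congr_fun h fun n => ?_
  rw [Real.negMulLog_mul]
  congr 1
  rw [Real.negMulLog, Real.log_pow]; ring

variable [CompleteSpace H]

theorem summable_thermalState (hx0 : 0 < x) (hx1 : x < 1) :
    Summable fun n : ℕ => (((1 - x) * x ^ n : ℝ) : ℂ) • InnerProductSpace.rankOne ℂ (e n) (e n) := by
  refine Summable.of_norm_bounded ((summable_geometric_of_lt_one hx0.le hx1).mul_left (1 - x))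
    fun n => ?_
  rw [norm_smul, InnerProductSpace.norm_rankOne, e.orthonormal.1, mul_one, mul_one, Complex.norm_real,
    Real.norm_of_nonneg (mul_nonneg (by linarith) (by positivity))]

theorem thermalState_apply_basis (hx0 : 0 < x) (hx1 : x < 1) (k : ℕ) :
    thermalState e x (e k) = (((1 - x) * x ^ k : ℝ) : ℂ) • e k := by
  have h := (summable_thermalState (e := e) hx0 hx1).hasSum.mapL (ContinuousLinearMap.apply ℂ H (e k))
  refine h.unique (HasSum.congr_fun (hasSum_ite_eq k ((((1 - x) * x ^ k : ℝ) : ℂ) • e k)) fun n => ?_)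
  rw [ContinuousLinearMap.apply_apply, smul_apply, InnerProductSpace.rankOne_apply,
    orthonormal_iff_ite.1 e.orthonormal]
  by_cases hn : n = k
  · subst hn; simp
  · simp [hn]

theorem isState_thermalState (hx0 : 0 < x) (hx1 : x < 1) : IsState e (thermalState e x) where
  isPositive := by
    rw [← ContinuousLinearMap.nonneg_iff_isPositive]
    refine tsum_nonneg fun n => ?_
    rw [ContinuousLinearMap.nonneg_iff_isPositive]
    refine (InnerProductSpace.isPositive_rankOne_self (e n)).smul_of_nonneg ?_
    rw [Complex.zero_le_real]
    exact mul_nonneg (by linarith) (by positivity)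
  trace_eq_one := by
    have h := (hasSum_geometric_of_lt_one hx0.le hx1).mul_left (1 - x)
    rw [mul_inv_cancel₀ (by linarith)] at h
    have h2 := Complex.hasSum_ofReal.2 h
    rw [Complex.ofReal_one] at h2
    refine HasSum.congr_fun h2 fun n => ?_
    rw [thermalState_apply_basis hx0 hx1, inner_smul_right, inner_self_eq_norm_sq_to_K,
      e.orthonormal.1]
    simp

theorem inner_thermalState_basis (hx0 : 0 < x) (hx1 : x < 1) (n : ℕ) :
    (⟪e n, thermalState e x (e n)⟫_ℂ).re = (1 - x) * x ^ n := by
  rw [thermalState_apply_basis hx0 hx1, inner_smul_right, inner_self_eq_norm_sq_to_K,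
      e.orthonormal.1]
  simp only [RCLike.ofReal_one, one_pow, mul_one, Complex.ofReal_re]

theorem meanPhotonNumber_thermalState (hx0 : 0 < x) (hx1 : x < 1) :
    meanPhotonNumber e (thermalState e x) = ENNReal.ofReal (x / (1 - x)) := by
  have hnorm : ‖x‖ < 1 := by rwa [Real.norm_of_nonneg hx0.le]
  have h := (hasSum_coe_mul_geometric_of_norm_lt_one hnorm).mul_left (1 - x)
  have h1 : 1 - x ≠ 0 := by linarith
  have h1' : 0 ≤ 1 - x := by linarith
  rw [show (1 - x) * (x / (1 - x) ^ 2) = x / (1 - x) by field_simp] at h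
  rw [← h.tsum_eq, ENNReal.ofReal_tsum_of_nonneg (fun n => by positivity) h.summable,
    meanPhotonNumber]
  refine tsum_congr fun n => ?_
  rw [inner_thermalState_basis hx0 hx1]
  congr 1; ring

theorem entropy_thermalState (hx0 : 0 < x) (hx1 : x < 1) :
    entropy e (thermalState e x) = ENNReal.ofReal (Real.binEntropy x / (1 - x)) := by
  have hρ := isState_thermalState (e := e) hx0 hx1
  have hsa : IsSelfAdjoint (cfc Real.negMulLog (thermalState e x)) := cfc_predicate _ _
  have h := hasSum_negMulLog_thermal hx0 hx1
  have h0 : ∀ n : ℕ, 0 ≤ Real.negMulLog ((1 - x) * x ^ n) := fun n => by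
    have h1 : x ^ n ≤ 1 := pow_le_one₀ hx0.le hx1.le
    have h2 : 0 < x ^ n := by positivity
    exact Real.negMulLog_nonneg (mul_nonneg (by linarith) h2.le) (by nlinarith)
  rw [← h.tsum_eq, ENNReal.ofReal_tsum_of_nonneg h0 h.summable]
  exact tsum_ofReal_inner_apply (e := e) (ContinuousLinearMap.isSelfAdjoint_iff_isSymmetric.1 hsa)
    (fun k => cfc_apply_of_apply_eq_smul hρ.isPositive.isSelfAdjoint Real.continuous_negMulLog
      (thermalState_apply_basis hx0 hx1 k)) h0

/-- Up to phases, every eigenbasis of a thermal state is a permutation of the Fock basis. -/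
theorem exists_equiv_eigenbasis_thermalState (hx0 : 0 < x) (hx1 : x < 1) :
    ∃ π : ℕ ≃ ℕ, (∀ k, eigenvalue e (thermalState e x) k = (1 - x) * x ^ π k) ∧
      ∀ k, ∃ c : ℂ, ‖c‖ = 1 ∧ eigenbasis e (thermalState e x) k = c • e (π k) := by
  have hρ := isState_thermalState (e := e) hx0 hx1
  set ψ := eigenbasis e (thermalState e x)
  set l := eigenvalue e (thermalState e x)
  have hx1' : 0 < 1 - x := by linarith
  -- The spectrum of a thermal state is simple, so each `ψ k` overlaps exactly one Fock state.
  have hcoef : ∀ k n, ⟪e n, ψ k⟫_ℂ ≠ 0 → l k = (1 - x) * x ^ n := by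
    intro k n hne
    have h1 : ⟪thermalState e x (e n), ψ k⟫_ℂ = ⟪e n, thermalState e x (ψ k)⟫_ℂ :=
      hρ.isPositive.isSymmetric_coe _ _
    rw [thermalState_apply_basis hx0 hx1, hρ.apply_eigenbasis, inner_smul_left, inner_smul_right,
      Complex.conj_ofReal] at h1
    exact (Complex.ofReal_injective (mul_right_cancel₀ hne h1)).symm
  have hex : ∀ k, ∃ n, ⟪e n, ψ k⟫_ℂ ≠ 0 := by
    intro k
    by_contra hcon
    push Not at hcon
    have h1 := hasSum_sq_norm_inner e (ψ k)
    simp only [hcon, ψ.orthonormal.1 k, norm_zero] at h1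
    have := h1.unique (a₂ := 0) (by simp [hasSum_zero])
    norm_num at this
  choose π hπ using hex
  have huniq : ∀ k n, ⟪e n, ψ k⟫_ℂ ≠ 0 → n = π k := by
    intro k n hne
    have h1 := (hcoef k n hne).symm.trans (hcoef k _ (hπ k))
    exact pow_right_injective₀ hx0 hx1.ne (mul_left_cancel₀ hx1'.ne' h1)
  have hψ : ∀ k, ψ k = ⟪e (π k), ψ k⟫_ℂ • e (π k) := by
    intro k
    have h1 := e.hasSum_repr (ψ k)
    refine h1.unique (hasSum_single (π k) fun n hn => ?_) |>.trans ?_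
    · rw [e.repr_apply_apply]
      have : ⟪e n, ψ k⟫_ℂ = 0 := by
        by_contra hne; exact hn (huniq k n hne)
      rw [this, zero_smul]
    · rw [e.repr_apply_apply]
  have hnorm : ∀ k, ‖⟪e (π k), ψ k⟫_ℂ‖ = 1 := by
    intro k
    have := congrArg norm (hψ k)
    rw [norm_smul, ψ.orthonormal.1, e.orthonormal.1, mul_one] at this
    exact this.symm
  have hinj : Function.Injective π := by
    intro k j hkj
    by_contra hne
    have h1 : ⟪ψ k, ψ j⟫_ℂ = 0 := ψ.orthonormal.2 hne
    rw [hψ k, hψ j, hkj, inner_smul_left, inner_smul_right, inner_self_eq_norm_sq_to_K,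
      e.orthonormal.1, ← hkj] at h1
    have h2 := hπ k
    have h3 := hπ j
    rw [← hkj] at h3
    simp only [mul_eq_zero, map_eq_zero, h2, h3, false_or, RCLike.ofReal_one, one_pow, one_ne_zero] at h1
  have hsurj : Function.Surjective π := by
    intro n
    by_contra hcon
    push Not at hcon
    have h1 := hasSum_sq_norm_inner ψ (e n)
    have h0 : ∀ k, ⟪ψ k, e n⟫_ℂ = 0 := by
      intro k
      by_contra hne
      rw [← inner_conj_symm] at hne
      exact hcon k (huniq k n fun h => hne (by rw [h, map_zero])).symm
    simp only [h0, e.orthonormal.1 n, norm_zero] at h1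
    have := h1.unique (a₂ := 0) (by simp [hasSum_zero])
    norm_num at this
  exact ⟨Equiv.ofBijective π ⟨hinj, hsurj⟩, fun k => hcoef k _ (hπ k), fun k => ⟨_, hnorm k, hψ k⟩⟩

/-- The phases drop out of the rates and the permutation out of the sum. The cost `φ` is left
general to serve both `jumpCost` and `logCost`. -/
theorem hasSum_cost_thermalState (hx0 : 0 < x) (hx1 : x < 1) {K : H → H}
    (hK : ∀ (c : ℂ) v, K (c • v) = c • K v) {φ : ℝ → ℝ → ℝ} {a : ℝ}
    (h : HasSum (fun y : ℕ × ℕ => φ ((1 - x) * x ^ y.1) ((1 - x) * x ^ y.2)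
      * ‖⟪e y.2, K (e y.1)⟫_ℂ‖ ^ 2) a) :
    HasSum (fun y : ℕ × ℕ => φ (eigenvalue e (thermalState e x) y.1)
        (eigenvalue e (thermalState e x) y.2)
      * ‖⟪eigenbasis e (thermalState e x) y.2, K (eigenbasis e (thermalState e x) y.1)⟫_ℂ‖ ^ 2) a := by
  obtain ⟨π, hl, hψ⟩ := exists_equiv_eigenbasis_thermalState (e := e) hx0 hx1
  refine HasSum.congr_fun ((Equiv.prodCongr π π).hasSum_iff.2 h) fun y => ?_
  obtain ⟨c, hc, hc'⟩ := hψ y.1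
  obtain ⟨d, hd, hd'⟩ := hψ y.2
  rw [hl, hl, hc', hd', hK, inner_smul_left, inner_smul_right, norm_mul, norm_mul, hc, RCLike.norm_conj,
    hd, one_mul, one_mul]
  rfl

/-- Only jumps `m → m + 1` occur, and by homogeneity each costs `(1 - x) x^m φ(1, x)` at rate `m +
1`. -/
theorem hasSum_creation_cost_thermalState (hx0 : 0 < x) (hx1 : x < 1) {φ : ℝ → ℝ → ℝ}
    (hφ : ∀ c a b : ℝ, 0 < c → 0 < a → 0 < b → φ (c * a) (c * b) = c * φ a b) :
    HasSum (fun y : ℕ × ℕ => φ (eigenvalue e (thermalState e x) y.1)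
        (eigenvalue e (thermalState e x) y.2)
      * ‖⟪eigenbasis e (thermalState e x) y.2, creation e (eigenbasis e (thermalState e x) y.1)⟫_ℂ‖ ^ 2)
      (φ 1 x / (1 - x)) := by
  refine hasSum_cost_thermalState hx0 hx1 creation_smul ?_
  have hinj : Function.Injective fun m : ℕ => (m, m + 1) := fun m n h => (Prod.ext_iff.1 h).1
  refine (hinj.hasSum_iff fun y hy => ?_).1 ?_
  · rw [inner_creation_basis, if_neg, mul_zero]
    exact fun h => hy ⟨y.1, Prod.ext rfl h.symm⟩
  · have h := (hasSum_succ_mul_thermal hx0 hx1).mul_left (φ 1 x)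
    rw [mul_one_div] at h
    refine HasSum.congr_fun h fun m => ?_
    have h1 := hφ ((1 - x) * x ^ m) 1 x (mul_pos (by linarith) (by positivity)) one_pos hx0
    rw [mul_one, mul_assoc, ← pow_succ] at h1
    simp only [Function.comp_apply, inner_creation_basis, if_true]
    rw [h1]; ring

theorem hasSum_annihilation_cost_thermalState (hx0 : 0 < x) (hx1 : x < 1) {φ : ℝ → ℝ → ℝ}
    (hφ : ∀ c a b : ℝ, 0 < c → 0 < a → 0 < b → φ (c * a) (c * b) = c * φ a b) :
    HasSum (fun y : ℕ × ℕ => φ (eigenvalue e (thermalState e x) y.1)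
        (eigenvalue e (thermalState e x) y.2)
      * ‖⟪eigenbasis e (thermalState e x) y.2,
          annihilation e (eigenbasis e (thermalState e x) y.1)⟫_ℂ‖ ^ 2)
      (φ x 1 / (1 - x)) := by
  refine hasSum_cost_thermalState hx0 hx1 annihilation_smul ?_
  have hinj : Function.Injective fun m : ℕ => (m + 1, m) := fun m n h => (Prod.ext_iff.1 h).2
  refine (hinj.hasSum_iff fun y hy => ?_).1 ?_
  · rw [inner_annihilation_basis, if_neg, mul_zero]
    exact fun h => hy ⟨y.2, Prod.ext h.symm rfl⟩
  · have h := (hasSum_succ_mul_thermal hx0 hx1).mul_left (φ x 1)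
    rw [mul_one_div] at h
    refine HasSum.congr_fun h fun m => ?_
    have h1 := hφ ((1 - x) * x ^ m) x 1 (mul_pos (by linarith) (by positivity)) hx0 one_pos
    rw [mul_one, mul_assoc, ← pow_succ] at h1
    simp only [Function.comp_apply, inner_annihilation_basis, if_true]
    rw [h1]; ring

theorem eigenvalue_thermalState_pos (hx0 : 0 < x) (hx1 : x < 1) (k : ℕ) :
    0 < eigenvalue e (thermalState e x) k := by
  obtain ⟨π, hl, -⟩ := exists_equiv_eigenbasis_thermalState (e := e) hx0 hx1
  rw [hl]
  exact mul_pos (by linarith) (by positivity)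

theorem jumpLogPairing_thermalState (hx0 : 0 < x) (hx1 : x < 1) {K : H → H} {a : ℝ}
    (h : HasSum (fun y : ℕ × ℕ => logCost (eigenvalue e (thermalState e x) y.1)
        (eigenvalue e (thermalState e x) y.2)
      * ‖⟪eigenbasis e (thermalState e x) y.2, K (eigenbasis e (thermalState e x) y.1)⟫_ℂ‖ ^ 2) a) :
    jumpLogPairing e K (thermalState e x) = a := by
  rw [← extSum_coe h, jumpLogPairing]
  congr 1
  funext y
  rw [ENNReal.log_ofReal_of_pos (eigenvalue_thermalState_pos hx0 hx1 _),
    ENNReal.log_ofReal_of_pos (eigenvalue_thermalState_pos hx0 hx1 _), ← EReal.coe_sub, ← EReal.coe_mul,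
    ← EReal.coe_mul, logCost]

/-- The value of `Υ` at a thermal state, for a first term with value `(A + B) / (1 - x)`. -/
theorem coe_add_meanPhotonNumber_add_entropy_thermalState (hx0 : 0 < x) (hx1 : x < 1) (A ω : ℝ) :
    ((A / (1 - x) : ℝ) : EReal) + (ω : EReal) * (meanPhotonNumber e (thermalState e x) : EReal)
        + (entropy e (thermalState e x) : EReal)
      = (((A + ω * x + Real.binEntropy x) / (1 - x) : ℝ) : EReal) := by
  have h1 : 0 < 1 - x := by linarith
  rw [meanPhotonNumber_thermalState hx0 hx1, entropy_thermalState hx0 hx1, EReal.coe_ennreal_ofReal,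
    EReal.coe_ennreal_ofReal, max_eq_left (by positivity),
    max_eq_left (div_nonneg (Real.binEntropy_nonneg hx0.le hx1.le) h1.le), ← EReal.coe_mul,
    ← EReal.coe_add, ← EReal.coe_add]
  congr 1; ring

theorem metaFunctional_thermalState_one (hx0 : 0 < x) (hx1 : x < 1) (ν₀ ν₁ ω : ℝ) :
    metaFunctional e ν₀ ν₁ ω 1 (thermalState e x)
      = (((ν₀ * logCost 1 x + ν₁ * logCost x 1 + ω * x + Real.binEntropy x) / (1 - x) : ℝ) : EReal) := by
  rw [metaFunctional, if_pos rfl, logPairing,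
    jumpLogPairing_thermalState hx0 hx1
      (hasSum_creation_cost_thermalState hx0 hx1 fun c a b => logCost_mul),
    jumpLogPairing_thermalState hx0 hx1
      (hasSum_annihilation_cost_thermalState hx0 hx1 fun c a b => logCost_mul),
    ← coe_add_meanPhotonNumber_add_entropy_thermalState (e := e) hx0 hx1, ← EReal.coe_mul, ← EReal.coe_mul,
    ← EReal.coe_add]
  congr 4; ring

theorem metaFunctional_thermalState (hx0 : 0 < x) (hx1 : x < 1) (ν₀ ν₁ ω : ℝ) {p : ℝ} (hp : 1 < p) :
    metaFunctional e ν₀ ν₁ ω p (thermalState e x)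
      = ((thermalCost (1 / p.conjExponent) ν₀ ν₁ ω x / (1 - x) : ℝ) : EReal) := by
  have hfin : meanPhotonNumber e (thermalState e x) < ∞ := by
    rw [meanPhotonNumber_thermalState hx0 hx1]; exact ENNReal.ofReal_lt_top
  have hφ : ∀ c a b : ℝ, 0 < c → 0 < a → 0 < b → jumpCost (1 / p.conjExponent) (c * a) (c * b)
      = c * jumpCost (1 / p.conjExponent) a b := fun c a b hc ha hb => jumpCost_mul hc.le ha.le hb.le
  have h0 := (hasSum_creation_cost_thermalState (e := e) hx0 hx1 hφ).tsum_eq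
  have h1 := (hasSum_annihilation_cost_thermalState (e := e) hx0 hx1 hφ).tsum_eq
  rw [metaFunctional, if_neg hp.ne',
    (isState_thermalState hx0 hx1).conjExponent_mul_powerPairing hfin hp, totalCost, totalCost]
  simp only [jumpRate, eigenvalue_thermalState_pos hx0 hx1, if_true]
  rw [h0, h1, thermalCost, ← coe_add_meanPhotonNumber_add_entropy_thermalState (e := e) hx0 hx1]
  congr 4; ring

/-! ### The meta log-Sobolev inequality -/

theorem IsState.le_metaFunctional {ρ : H →L[ℂ] H} (hρ : IsState e ρ)
    (hfin : meanPhotonNumber e ρ < ∞) {ν₀ ν₁ ω η p : ℝ} (hν₀ : 0 ≤ ν₀) (hν₁ : 0 ≤ ν₁) (hω : 0 ≤ ω)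
    (hp : 1 < p)
    (hη : ∀ x ∈ Set.Ioo (0 : ℝ) 1, η * (1 - x) ≤ thermalCost (1 / p.conjExponent) ν₀ ν₁ ω x) :
    (η : EReal) ≤ metaFunctional e ν₀ ν₁ ω p ρ := by
  have hq : p.conjExponent.HolderConjugate p := (Real.HolderConjugate.conjExponent hp).symm
  rw [metaFunctional, if_neg hp.ne', hρ.conjExponent_mul_powerPairing hfin hp]
  exact hρ.le_of_thermalCost hfin (one_div_pos.2 hq.pos)
    ((div_lt_one hq.pos).2 hq.lt) hν₀ hν₁ hω hη

theorem IsState.le_metaFunctional_one {ρ : H →L[ℂ] H} (hρ : IsState e ρ)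
    (hfin : meanPhotonNumber e ρ < ∞) {ν₀ ν₁ ω η : ℝ} (hν₀ : 0 ≤ ν₀) (hν₁ : 0 ≤ ν₁) (hω : 0 ≤ ω)
    (hη : ∀ x ∈ Set.Ioo (0 : ℝ) 1, η * (1 - x)
      ≤ ν₀ * logCost 1 x + ν₁ * logCost x 1 + ω * x + Real.binEntropy x) :
    (η : EReal) ≤ metaFunctional e ν₀ ν₁ ω 1 ρ := by
  have key : ∀ ε : ℝ, 0 < ε → ((η - ε : ℝ) : EReal) ≤ metaFunctional e ν₀ ν₁ ω 1 ρ := by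
    intro ε hε
    obtain ⟨s, hs0, hs1, hs⟩ := exists_thermalCost_ge hν₀ hν₁ hω hε hη
    refine (hρ.le_of_thermalCost hfin hs0 hs1 hν₀ hν₁ hω hs).trans ?_
    rw [metaFunctional, if_pos rfl, logPairing, EReal.coe_add, EReal.coe_mul, EReal.coe_mul]
    have h0 := hρ.totalCost_le_jumpLogPairing hs0 hs1 (K := creation e)
      (summable_jumpCost_mul hs0 hs1 hρ.eigenvalue_nonneg (jumpRate_nonneg _)
        (jumpRate_nonneg (annihilation e)) (fun k hk => hρ.hasSum_jumpRate_creation hfin hk)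
        (fun k hk => hasSum_jumpRate hk) (hρ.summable_eigenvalue_mul_add_one hfin)
        (hρ.summable_eigenvalue_mul hfin) (hρ.jumpRate_creation_le hfin))
    have h1 := hρ.totalCost_le_jumpLogPairing hs0 hs1 (K := annihilation e)
      (summable_jumpCost_mul hs0 hs1 hρ.eigenvalue_nonneg (jumpRate_nonneg _)
        (jumpRate_nonneg (creation e)) (fun k hk => hasSum_jumpRate hk)
        (fun k hk => hρ.hasSum_jumpRate_creation hfin hk) (hρ.summable_eigenvalue_mul hfin)
        (hρ.summable_eigenvalue_mul_add_one hfin) (hρ.jumpRate_annihilation_le hfin))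
    gcongr
  -- Letting `ε → 0` in the extended reals: the value `⊥` is excluded by a real lower bound.
  generalize metaFunctional e ν₀ ν₁ ω 1 ρ = y at *
  induction y with
  | bot => exact absurd (le_bot_iff.1 (key 1 one_pos)) (EReal.coe_ne_bot _)
  | top => exact le_top
  | coe m =>
    refine EReal.coe_le_coe_iff.2 (le_of_forall_pos_sub_le fun ε hε => ?_)
    exact EReal.coe_le_coe_iff.1 (key ε hε)

end Thermal

theorem theorem1 {H : Type*} [NormedAddCommGroup H] [InnerProductSpace ℂ H] [CompleteSpace H]
    (e : HilbertBasis ℕ ℂ H) (ν₀ ν₁ ω p : ℝ) (hν₀ : 0 ≤ ν₀) (hν₁ : 0 ≤ ν₁) (hω : 0 ≤ ω) (hp : 1 ≤ p)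
    (ρ : H →L[ℂ] H) (hρ : IsState e ρ) (hfin : meanPhotonNumber e ρ < ∞) :
    thermalInfimum e ν₀ ν₁ ω p ≤ metaFunctional e ν₀ ν₁ ω p ρ := by
  have hle : ∀ x ∈ Set.Ioo (0 : ℝ) 1, thermalInfimum e ν₀ ν₁ ω p
      ≤ metaFunctional e ν₀ ν₁ ω p (thermalState e x) := fun x hx => iInf_le _ (⟨x, hx⟩ : Set.Ioo (0 : ℝ) 1)
  -- One thermal state with a real value of `Υ` rules out `⊤` for the infimum.
  have hhalf : (1 / 2 : ℝ) ∈ Set.Ioo (0 : ℝ) 1 := by constructor <;> norm_num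
  rcases hp.eq_or_lt with rfl | hp
  · generalize thermalInfimum e ν₀ ν₁ ω 1 = y at *
    induction y with
    | bot => exact bot_le
    | top =>
      have := hle _ hhalf
      rw [metaFunctional_thermalState_one hhalf.1 hhalf.2] at this
      exact absurd (top_le_iff.1 this) (EReal.coe_ne_top _)
    | coe η =>
      refine hρ.le_metaFunctional_one hfin hν₀ hν₁ hω fun x hx => ?_
      have := hle x hx
      rw [metaFunctional_thermalState_one hx.1 hx.2, EReal.coe_le_coe_iff,
        le_div_iff₀ (by linarith [hx.2])] at this
      exact this
  · generalize thermalInfimum e ν₀ ν₁ ω p = y at *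
    induction y with
    | bot => exact bot_le
    | top =>
      have := hle _ hhalf
      rw [metaFunctional_thermalState hhalf.1 hhalf.2 _ _ _ hp] at this
      exact absurd (top_le_iff.1 this) (EReal.coe_ne_top _)
    | coe η =>
      refine hρ.le_metaFunctional hfin hν₀ hν₁ hω hp fun x hx => ?_
      have := hle x hx
      rw [metaFunctional_thermalState hx.1 hx.2 _ _ _ hp, EReal.coe_le_coe_iff,
        le_div_iff₀ (by linarith [hx.2])] at this
      exact this
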